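/- Let $n\ge 1$ be an integer, $\alpha>0$ and $1<q\le 1+\frac{\alpha}{n}$. Let $$\mathcal L=\sum_{i,j=1}^n\frac{\partial}{\partial x_i}\Big[a_{ij}(t,x)\frac{\partial}{\partial x_j}\Big],$$ where the coefficients $a_{ij}$ are measurable, locally bounded functions on $\mathbb R\times\mathbb R^n$ with $a_{ij}=a_{ji}$ almost everywhere and $$0\le\sum_{i,j=1}^n a_{ij}(t,x)\xi_i\xi_j\le A(t,x)|\xi|^2$$ for all $\xi\in\mathbb R^n$ and almost all $(t,x)$, for some measurable, non-negative, locally bounded function $A$ on $\mathbb R\times\mathbb R^n$. Assume that for some constant $c>0$ $$\operatorname*{ess\,sup}_{(t,x)\in\mathbb R\times\{R/2<|x|<R\}}A(t,x)\le c\,R^{2-\alpha}\qquad\text{for all }R>1 .$$ For a bounded domain $\Omega\subset\mathbb R\times\mathbb R^n$ let $W^{\mathcal L,q}(\Omega)$ be the completion of the space of functions $w\in C^\infty(\Omega)$ of finite norm $$\int_\Omega|w_t|\,dt\,dx+\Big[\int_\Omega\sum_{i,j=1}^n a_{ij}\frac{\partial w}{\partial x_i}\frac{\partial w}{\partial x_j}\,dt\,dx\Big]^{1/2}+\Big[\int_\Omega|w|^{q}\,dt\,dx\Big]^{1/q}.$$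 An element of it is a triple $(w,w_t,\nabla_x w)$ of limits in the three parts of the norm, $\nabla_xw$ being determined up to vector fields annihilated by $(a_{ij})$. A weak solution of $u_t\ge\mathcal Lu+|u|^{q-1}u$ in $\mathbb R\times\mathbb R^n$ is a measurable function $u$ which, with some $u_t$ and $\nabla_xu$ defined on $\mathbb R\times\mathbb R^n$, belongs to $W^{\mathcal L,q}(\Omega)$ for every bounded domain $\Omega$, and satisfies $$\int_{\mathbb R\times\mathbb R^n}\Big[u_t\varphi+\sum_{i,j=1}^n a_{ij}\frac{\partial\varphi}{\partial x_i}\frac{\partial u}{\partial x_j}-|u|^{q-1}u\,\varphi\Big]dt\,dx\ge 0$$ for every non-negative $\varphi\in C^\infty(\mathbb R\times\mathbb R^n)$ with compact support; a weak solution of $v_t\le\mathcal Lv+|v|^{q-1}v$ is defined in the same way with $\le 0$. If $u$ is a weak solution of $u_t\ge\mathcal Lu+|u|^{q-1}u$ and $v$ is a weak solution of $v_t\le\mathcal Lv+|v|^{q-1}v$ in $\mathbb R\times\mathbb R^n$ such that $u\ge v$ almost everywhere, then $u=v$ almost everywhere in $\mathbb R\times\mathbb R^n$. -/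

import Mathlib

open MeasureTheory Filter Topology
open scoped ENNReal ContDiff

noncomputable section

namespace ParabolicLiouville

/-- The space-time `ℝ × ℝⁿ`, with points `p = (t, x)`; its `volume` is the Lebesgue measure. -/
abbrev SpaceTime (n : ℕ) : Type := ℝ × EuclideanSpace ℝ (Fin n)

/-- The classical time derivative `w_t`. -/
def timeDeriv {n : ℕ} (w : SpaceTime n → ℝ) (p : SpaceTime n) : ℝ :=
  fderiv ℝ w p (1, 0)

/-- The classical spatial gradient `(∂w/∂x₁, …, ∂w/∂xₙ)`. -/
def spaceGrad {n : ℕ} (w : SpaceTime n → ℝ) (p : SpaceTime n) : EuclideanSpace ℝ (Fin n) :=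
  WithLp.toLp 2 fun i => fderiv ℝ w p (0, EuclideanSpace.single i 1)

/-- The form `∑ᵢⱼ mᵢⱼ ξᵢ ηⱼ`. -/
def bilin {n : ℕ} (m : Matrix (Fin n) (Fin n) ℝ) (ξ η : EuclideanSpace ℝ (Fin n)) : ℝ :=
  ∑ i, ∑ j, m i j * ξ i * η j

/-- Boundedness on every compact subset of `ℝ × ℝⁿ`. -/
def LocallyBounded {n : ℕ} (f : SpaceTime n → ℝ) : Prop :=
  ∀ K : Set (SpaceTime n), IsCompact K → ∃ M : ℝ, ∀ p ∈ K, |f p| ≤ M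

/-- The standing assumptions on the coefficients `a` of `𝓛 = ∑ᵢⱼ ∂ᵢ(aᵢⱼ(t,x) ∂ⱼ)`
and on the function `A` bounding its quadratic form. -/
structure IsCoefficient {n : ℕ} (a : SpaceTime n → Matrix (Fin n) (Fin n) ℝ)
    (A : SpaceTime n → ℝ) : Prop where
  aemeasurable : ∀ i j, AEMeasurable (fun p => a p i j) volume
  locallyBounded : ∀ i j, LocallyBounded fun p => a p i j
  symm : ∀ᵐ p, ∀ i j, a p i j = a p j i
  aemeasurable_bound : AEMeasurable A volume
  locallyBounded_bound : LocallyBounded A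
  nonneg_bound : ∀ p, 0 ≤ A p
  form_nonneg : ∀ᵐ p, ∀ ξ : EuclideanSpace ℝ (Fin n), 0 ≤ bilin (a p) ξ ξ
  form_le : ∀ᵐ p, ∀ ξ : EuclideanSpace ℝ (Fin n), bilin (a p) ξ ξ ≤ A p * ‖ξ‖ ^ 2

/-- `ess sup` of `A ≥ 0` over `(-∞, ∞) × {R/2 < |x| < R}`, with values in `[0, ∞]`. -/
def annulusSup {n : ℕ} (A : SpaceTime n → ℝ) (R : ℝ) : ℝ≥0∞ :=
  essSup (fun p => ENNReal.ofReal (A p))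
    (volume.restrict {p : SpaceTime n | R / 2 < ‖p.2‖ ∧ ‖p.2‖ < R})

/-- The expression
`∫_Ω |s| + [∫_Ω ∑ᵢⱼ aᵢⱼ Gᵢ Gⱼ]^{1/2} + [∫_Ω |w|^q̂]^{1/q̂}`, `q̂ = max {1, q}`, in `[0, ∞]`;
for `s = w_t` and `G = ∇ₓ w` it is the norm of `w` in `W^{𝓛,q}(Ω)`. -/
def energyNorm {n : ℕ} (a : SpaceTime n → Matrix (Fin n) (Fin n) ℝ) (q : ℝ)
    (Ω : Set (SpaceTime n)) (w s : SpaceTime n → ℝ)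
    (G : SpaceTime n → EuclideanSpace ℝ (Fin n)) : ℝ≥0∞ :=
  (∫⁻ p in Ω, ENNReal.ofReal |s p|)
    + (∫⁻ p in Ω, ENNReal.ofReal (bilin (a p) (G p) (G p))) ^ (1 / 2 : ℝ)
    + (∫⁻ p in Ω, ENNReal.ofReal (|w p| ^ max 1 q)) ^ (1 / max 1 q)

/-- `w`, with time derivative `s` and spatial gradient `G`, is an element of `W^{𝓛,q}(Ω)`, the
completion of the smooth functions on `Ω` of finite norm: there are such functions `w k` with
`(w k, (w k)_t, ∇ₓ (w k)) → (w, s, G)` in the three seminorms that make up the norm.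

The three components of a Cauchy sequence converge in `L^q̂(Ω)`, in `L¹(Ω)` and in the space of
vector fields that are square integrable for the form of `a`, and two Cauchy sequences define the
same element of the completion iff the three limits agree. So the elements of the completion are
exactly these triples, where `w` and `s` count up to null sets and `G` up to fields that the form
of `a` annihilates almost everywhere. -/
def MemW {n : ℕ} (a : SpaceTime n → Matrix (Fin n) (Fin n) ℝ) (q : ℝ)
    (Ω : Set (SpaceTime n)) (w s : SpaceTime n → ℝ)
    (G : SpaceTime n → EuclideanSpace ℝ (Fin n)) : Prop :=
  ∃ f : ℕ → SpaceTime n → ℝ,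
    (∀ k, ContDiffOn ℝ ∞ (f k) Ω) ∧
    (∀ k, energyNorm a q Ω (f k) (timeDeriv (f k)) (spaceGrad (f k)) < ⊤) ∧
    Tendsto (fun k => energyNorm a q Ω (fun p => f k p - w p)
      (fun p => timeDeriv (f k) p - s p) (fun p => spaceGrad (f k) p - G p)) atTop (𝓝 0)

/-- `w`, with time derivative `s` and spatial gradient `G`, is a measurable function in
`W^{𝓛,q}_loc(ℝ × ℝⁿ)`: it is in `W^{𝓛,q}(Ω)` for every bounded domain `Ω`. -/
structure MemWLoc {n : ℕ} (a : SpaceTime n → Matrix (Fin n) (Fin n) ℝ) (q : ℝ)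
    (w s : SpaceTime n → ℝ) (G : SpaceTime n → EuclideanSpace ℝ (Fin n)) : Prop where
  aemeasurable : AEMeasurable w volume
  aemeasurable_timeDeriv : AEMeasurable s volume
  aemeasurable_grad : AEMeasurable G volume
  memW : ∀ Ω : Set (SpaceTime n), IsOpen Ω → IsConnected Ω → Bornology.IsBounded Ω →
    MemW a q Ω w s G

/-- Non-negative smooth test functions with compact support in `ℝ × ℝⁿ`. -/
structure IsTest {n : ℕ} (φ : SpaceTime n → ℝ) : Prop where
  smooth : ContDiff ℝ ∞ φ
  compact : HasCompactSupport φ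
  nonneg : ∀ p, 0 ≤ φ p

/-- `∫ [w_t φ + ∑ᵢⱼ aᵢⱼ (∂φ/∂xᵢ) (∂w/∂xⱼ) - |w|^{q-1} w φ] dt dx`, with `s` for `w_t` and `G` for
the spatial gradient of `w`. The integrand is integrable if `MemWLoc a q w s G`. -/
def weakForm {n : ℕ} (a : SpaceTime n → Matrix (Fin n) (Fin n) ℝ) (q : ℝ)
    (w s : SpaceTime n → ℝ) (G : SpaceTime n → EuclideanSpace ℝ (Fin n))
    (φ : SpaceTime n → ℝ) : ℝ :=
  ∫ p, (s p * φ p + bilin (a p) (spaceGrad φ p) (G p) - |w p| ^ (q - 1) * w p * φ p)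

/-- `u` is a weak solution of `u_t ≥ 𝓛u + |u|^{q-1}u` in `ℝ × ℝⁿ`. -/
def IsWeakSupersolution {n : ℕ} (a : SpaceTime n → Matrix (Fin n) (Fin n) ℝ) (q : ℝ)
    (u : SpaceTime n → ℝ) : Prop :=
  ∃ (s : SpaceTime n → ℝ) (G : SpaceTime n → EuclideanSpace ℝ (Fin n)),
    MemWLoc a q u s G ∧ ∀ φ, IsTest φ → 0 ≤ weakForm a q u s G φ

/-- `v` is a weak solution of `v_t ≤ 𝓛v + |v|^{q-1}v` in `ℝ × ℝⁿ`. -/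
def IsWeakSubsolution {n : ℕ} (a : SpaceTime n → Matrix (Fin n) (Fin n) ℝ) (q : ℝ)
    (v : SpaceTime n → ℝ) : Prop :=
  ∃ (s : SpaceTime n → ℝ) (G : SpaceTime n → EuclideanSpace ℝ (Fin n)),
    MemWLoc a q v s G ∧ ∀ φ, IsTest φ → weakForm a q v s G φ ≤ 0

end ParabolicLiouville

end

/-!
The difference `w = u - v ≥ 0` of the two solutions is a weak solution of `w_t ≥ 𝓛w + κ w^q` with
`κ = 2^{1-q}`, because `|u|^{q-1}u - |v|^{q-1}v ≥ κ (u - v)^q` for `u ≥ v`. The theorem is therefore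
a Liouville theorem of Fujita type for this inequality, which is proved by the test function
method.

Let `Z` be a parabolic cutoff function at scale `R`, equal to `1` for `|t| < R^α`, `|x| < R/2`. The
growth condition on `A` makes both `|Z_t|` and the energy density of `Z` at most of order `R^{-α}`,
that is `e^{q-1}` for `e = R^{-α/(q-1)}`, and the condition `q ≤ 1 + α/n` says that the support of
`Z` has a volume of order at most `R^{α+n} ≤ e^{-q}`. In terms of `e` all estimates below are
scale invariant.

* `WeakInequality.test_comp`: functions `h(w) ζ`, with `h` smooth and bounded with bounded
  derivative, are admissible in the weak inequality. They are limits of the test functions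
  `h(F k) ζ`, for smooth `F k` approximating `w` locally.
* `exists_energy_estimate`: testing with `(w + ε)^{-ν} Z^m`, where `0 < ε ≤ e` and `ν` is small,
  bounds the weighted energy `∫ (w + ε)^{-ν-1} a(∇w, ∇w) Z^m` by a multiple of `e^{-ν}`. The cross
  term is absorbed by the energy, and the terms with derivatives of `Z` are absorbed by the
  nonlinearity, using Young's inequality pointwise.
* `exists_cutoff_estimate`: testing with `Z^m` gives a bound for `∫ w^q Z^m` in which the cross term
  is controlled by the weighted energy. The remaining terms live on the set where `Z` is not
  locally constant.
* `exists_uniform_bound`, `exists_tail_bound`: absorbing these terms into the nonlinearity once more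
  shows that `∫ w^q Z^m` is bounded uniformly in `R`, so `w^q` is integrable over the space-time;
  then the same terms are small for large `R`, since they are controlled by the tail of the
  convergent integral `∫ w^q`. Hence `∫ w^q = 0`.

The second pass is what includes the critical exponent `q = 1 + α/n`, where the first one only
gives boundedness.
-/

open MeasureTheory Filter Topology
open scoped ENNReal ContDiff

noncomputable section

namespace ParabolicLiouville

/-! ### Positive semidefinite forms -/

section Form

variable {n : ℕ} {m : Matrix (Fin n) (Fin n) ℝ}

lemma bilin_add_left (ξ ξ' η : EuclideanSpace ℝ (Fin n)) :
    bilin m (ξ + ξ') η = bilin m ξ η + bilin m ξ' η := by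
  simp [bilin, mul_add, add_mul, Finset.sum_add_distrib]

lemma bilin_add_right (ξ η η' : EuclideanSpace ℝ (Fin n)) :
    bilin m ξ (η + η') = bilin m ξ η + bilin m ξ η' := by
  simp [bilin, mul_add, Finset.sum_add_distrib]

lemma bilin_smul_left (c : ℝ) (ξ η : EuclideanSpace ℝ (Fin n)) :
    bilin m (c • ξ) η = c * bilin m ξ η := by
  simp only [bilin, Finset.mul_sum, PiLp.smul_apply, smul_eq_mul]
  exact Finset.sum_congr rfl fun i _ => Finset.sum_congr rfl fun j _ => by ring

lemma bilin_smul_right (c : ℝ) (ξ η : EuclideanSpace ℝ (Fin n)) :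
    bilin m ξ (c • η) = c * bilin m ξ η := by
  simp only [bilin, Finset.mul_sum, PiLp.smul_apply, smul_eq_mul]
  exact Finset.sum_congr rfl fun i _ => Finset.sum_congr rfl fun j _ => by ring

lemma bilin_neg_right (ξ η : EuclideanSpace ℝ (Fin n)) : bilin m ξ (-η) = -bilin m ξ η := by
  simpa using bilin_smul_right (m := m) (-1) ξ η

lemma bilin_sub_left (ξ ξ' η : EuclideanSpace ℝ (Fin n)) :
    bilin m (ξ - ξ') η = bilin m ξ η - bilin m ξ' η := by
  simp [bilin, mul_sub, sub_mul, Finset.sum_sub_distrib]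

lemma bilin_sub_right (ξ η η' : EuclideanSpace ℝ (Fin n)) :
    bilin m ξ (η - η') = bilin m ξ η - bilin m ξ η' := by
  rw [sub_eq_add_neg, bilin_add_right, bilin_neg_right, sub_eq_add_neg]

lemma bilin_comm (hs : ∀ i j, m i j = m j i) (ξ η : EuclideanSpace ℝ (Fin n)) :
    bilin m ξ η = bilin m η ξ := by
  unfold bilin
  rw [Finset.sum_comm]
  exact Finset.sum_congr rfl fun i _ => Finset.sum_congr rfl fun j _ => by rw [hs j i]; ring

/-- The coefficient matrix is symmetric and positive semidefinite. -/
structure IsPosSemidefForm (m : Matrix (Fin n) (Fin n) ℝ) : Prop where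
  symm : ∀ i j, m i j = m j i
  nonneg : ∀ ξ : EuclideanSpace ℝ (Fin n), 0 ≤ bilin m ξ ξ

lemma IsPosSemidefForm.sq_le (hm : IsPosSemidefForm m) (ξ η : EuclideanSpace ℝ (Fin n)) :
    bilin m ξ η ^ 2 ≤ bilin m ξ ξ * bilin m η η := by
  have h := discrim_le_zero (a := bilin m η η) (b := 2 * bilin m ξ η) (c := bilin m ξ ξ) fun t => by
    have := hm.nonneg (ξ + t • η)
    rw [bilin_add_left, bilin_add_right, bilin_add_right, bilin_smul_left, bilin_smul_left,
      bilin_smul_right, bilin_smul_right, bilin_comm hm.symm η ξ] at this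
    linarith
  unfold discrim at h
  linarith

/-- The Cauchy-Schwarz inequality. -/
lemma IsPosSemidefForm.abs_le_sqrt (hm : IsPosSemidefForm m) (ξ η : EuclideanSpace ℝ (Fin n)) :
    |bilin m ξ η| ≤ √(bilin m ξ ξ) * √(bilin m η η) := by
  rw [← Real.sqrt_mul (hm.nonneg ξ)]
  exact Real.abs_le_sqrt (hm.sq_le ξ η)

lemma IsPosSemidefForm.abs_le_weighted (hm : IsPosSemidefForm m) {l : ℝ} (hl : 0 < l)
    (ξ η : EuclideanSpace ℝ (Fin n)) :
    |bilin m ξ η| ≤ l / 2 * bilin m η η + bilin m ξ ξ / (2 * l) := by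
  refine (hm.abs_le_sqrt ξ η).trans ?_
  have h1 := Real.sq_sqrt (hm.nonneg ξ)
  have h2 := Real.sq_sqrt (hm.nonneg η)
  rw [← h1, ← h2, Real.sqrt_sq (Real.sqrt_nonneg _), Real.sqrt_sq (Real.sqrt_nonneg _),
    div_mul_eq_mul_div, div_add_div _ _ two_ne_zero (by positivity), le_div_iff₀ (by positivity)]
  nlinarith [sq_nonneg (l * √(bilin m η η) - √(bilin m ξ ξ))]

lemma IsPosSemidefForm.sub_le (hm : IsPosSemidefForm m) (ξ η : EuclideanSpace ℝ (Fin n)) :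
    bilin m (ξ - η) (ξ - η) ≤ 2 * bilin m ξ ξ + 2 * bilin m η η := by
  have h := hm.nonneg (ξ + η)
  rw [bilin_add_left, bilin_add_right, bilin_add_right] at h
  rw [bilin_sub_left, bilin_sub_right, bilin_sub_right]
  linarith

lemma IsCoefficient.isPosSemidefForm {a : SpaceTime n → Matrix (Fin n) (Fin n) ℝ}
    {A : SpaceTime n → ℝ} (ha : IsCoefficient a A) : ∀ᵐ p, IsPosSemidefForm (a p) := by
  filter_upwards [ha.symm, ha.form_nonneg] with p h1 h2 using ⟨h1, h2⟩

lemma IsCoefficient.aemeasurable_bilin {a : SpaceTime n → Matrix (Fin n) (Fin n) ℝ}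
    {A : SpaceTime n → ℝ} (ha : IsCoefficient a A) {μ : Measure (SpaceTime n)} (hμ : μ ≪ volume)
    {G H : SpaceTime n → EuclideanSpace ℝ (Fin n)} (hG : AEMeasurable G μ)
    (hH : AEMeasurable H μ) : AEMeasurable (fun p => bilin (a p) (G p) (H p)) μ := by
  unfold bilin
  refine Finset.aemeasurable_fun_sum _ fun i _ => Finset.aemeasurable_fun_sum _ fun j _ => ?_
  have h1 : AEMeasurable (fun p => G p i) μ :=
    (EuclideanSpace.proj (𝕜 := ℝ) i).continuous.measurable.comp_aemeasurable hG
  have h2 : AEMeasurable (fun p => H p j) μ :=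
    (EuclideanSpace.proj (𝕜 := ℝ) j).continuous.measurable.comp_aemeasurable hH
  exact (((ha.aemeasurable i j).mono_ac hμ).mul h1).mul h2

end Form

/-! ### Inequalities between powers -/

/-- The monotonicity of the nonlinearity `τ ↦ |τ|^{q-1} τ`, in quantitative form. -/
lemma rpow_sub_le_signed_rpow_sub {q x y : ℝ} (hq : 1 ≤ q) (hxy : y ≤ x) :
    (2 : ℝ) ^ (1 - q) * (x - y) ^ q ≤ |x| ^ (q - 1) * x - |y| ^ (q - 1) * y := by
  have hpow : ∀ z : ℝ, 0 ≤ z → |z| ^ (q - 1) * z = z ^ q := by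
    intro z hz
    rw [abs_of_nonneg hz]
    rcases hz.eq_or_lt with rfl | hz'
    · rw [mul_zero, Real.zero_rpow (by linarith)]
    · conv_lhs => rw [← Real.rpow_one z, ← Real.rpow_mul hz, ← Real.rpow_add hz']
      congr 1; ring
  have h2 : (2 : ℝ) ^ (1 - q) ≤ 1 := Real.rpow_le_one_of_one_le_of_nonpos (by norm_num) (by linarith)
  have hmono : ∀ x y : ℝ, 0 ≤ y → y ≤ x → (2 : ℝ) ^ (1 - q) * (x - y) ^ q ≤ x ^ q - y ^ q := by
    intro x y hy hxy
    have h := Real.add_rpow_le_rpow_add (sub_nonneg.2 hxy) hy hq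
    rw [sub_add_cancel] at h
    have := mul_le_mul_of_nonneg_right h2 (Real.rpow_nonneg (sub_nonneg.2 hxy) q)
    linarith
  have hneg : ∀ z : ℝ, z ≤ 0 → |z| ^ (q - 1) * z = -(-z) ^ q := by
    intro z hz
    rw [← hpow (-z) (by linarith), abs_neg]; ring
  rcases le_total 0 y with hy | hy
  · rw [hpow x (hy.trans hxy), hpow y hy]
    exact hmono x y hy hxy
  · rcases le_total 0 x with hx | hx
    · rw [hpow x hx, hneg y hy]
      have h : (x + -y) ^ q ≤ 2 ^ (q - 1) * (x ^ q + (-y) ^ q) := by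
        exact_mod_cast NNReal.rpow_add_le_mul_rpow_add_rpow ⟨x, hx⟩ ⟨-y, by linarith⟩ hq
      have h3 : (2 : ℝ) ^ (1 - q) * 2 ^ (q - 1) = 1 := by
        rw [← Real.rpow_add (by norm_num)]; simp
      have h4 := mul_le_mul_of_nonneg_left h (Real.rpow_nonneg (zero_le_two (α := ℝ)) (1 - q))
      rw [← mul_assoc, h3, one_mul, ← sub_eq_add_neg] at h4
      linarith
    · rw [hneg x hx, hneg y hy]
      have h := hmono (-y) (-x) (by linarith) (by linarith)
      rw [show -y - -x = x - y by ring] at h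
      linarith

/-- A form of Young's inequality; the optimal constant is not needed. -/
lemma exists_young {p q : ℝ} (hp : 0 < p) (hpq : p < q) {η : ℝ} (hη : 0 < η) :
    ∃ C : ℝ, 0 < C ∧ ∀ X Y : ℝ, 0 ≤ X → 0 ≤ Y →
      X ^ p * Y ^ (q - p) ≤ η * X ^ q + C * Y ^ q := by
  have hr : 0 < q - p := by linarith
  set κ : ℝ := η ^ (1 / (q - p)) with hκ
  have hκ0 : 0 < κ := Real.rpow_pos_of_pos hη _
  have hκη : κ ^ (q - p) = η := by
    rw [hκ, ← Real.rpow_mul hη.le, one_div_mul_cancel hr.ne', Real.rpow_one]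
  have hsplit : ∀ X : ℝ, 0 ≤ X → X ^ p * X ^ (q - p) = X ^ q := fun X hX => by
    rw [← Real.rpow_add_of_nonneg hX hp.le hr.le]; congr 1; ring
  refine ⟨(1 / κ) ^ p, by positivity, fun X Y hX hY => ?_⟩
  have hXq := Real.rpow_nonneg hX q
  have hYq := Real.rpow_nonneg hY q
  rcases le_total Y (κ * X) with h | h
  · have h1 : Y ^ (q - p) ≤ η * X ^ (q - p) := by
      rw [← hκη, ← Real.mul_rpow hκ0.le hX]
      exact Real.rpow_le_rpow hY h hr.le
    have h2 := mul_le_mul_of_nonneg_left h1 (Real.rpow_nonneg hX p)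
    have h3 : X ^ p * (η * X ^ (q - p)) = η * X ^ q := by rw [← hsplit X hX]; ring
    have : 0 ≤ (1 / κ) ^ p * Y ^ q := by positivity
    linarith
  · have h1 : X ^ p ≤ (1 / κ) ^ p * Y ^ p := by
      rw [← Real.mul_rpow (by positivity) hY]
      refine Real.rpow_le_rpow hX ?_ hp.le
      rw [one_div, ← div_eq_inv_mul, le_div_iff₀ hκ0]; linarith
    have h2 := mul_le_mul_of_nonneg_right h1 (Real.rpow_nonneg hY (q - p))
    rw [mul_assoc, hsplit Y hY] at h2
    have : 0 ≤ η * X ^ q := by positivity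
    linarith

/-- Young's inequality with a cutoff `Z`: a high power `s` makes up for the two powers of `Z`
which are lost when `Z ^ s` is differentiated. -/
lemma exists_young_cutoff {p q : ℝ} (hp : 0 < p) (hpq : p < q) {η : ℝ} (hη : 0 < η) {s : ℕ}
    (hs : 2 * q ≤ s * (q - p)) :
    ∃ C : ℝ, 0 < C ∧ ∀ W Z e : ℝ, 0 ≤ W → 0 ≤ Z → Z ≤ 1 → 0 ≤ e →
      W ^ p * e ^ (q - p) * Z ^ (s - 2) ≤ η * (W ^ q * Z ^ s) + C * e ^ q := by
  obtain ⟨C, hC, h⟩ := exists_young hp hpq hη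
  refine ⟨C, hC, fun W Z e hW hZ hZ1 he => ?_⟩
  have hq : 0 < q := hp.trans hpq
  have hs2 : (2 : ℝ) ≤ s := by
    by_contra! hlt
    have h0 : (0 : ℝ) ≤ s := Nat.cast_nonneg s
    nlinarith
  have hs2' : 2 ≤ s := by exact_mod_cast hs2
  have key : Z ^ (s - 2) ≤ (Z ^ ((s : ℝ) / q)) ^ p := by
    rw [← Real.rpow_mul hZ, ← Real.rpow_natCast]
    rcases hZ.eq_or_lt with rfl | hZ0
    · have hpos : (0 : ℝ) < s / q * p := by positivity
      have : ((s - 2 : ℕ) : ℝ) ≠ 0 := by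
        push_cast [hs2']
        intro h0
        have : (s : ℝ) = 2 := by linarith
        rw [this] at hs
        nlinarith
      rw [Real.zero_rpow this, Real.zero_rpow hpos.ne']
    · refine Real.rpow_le_rpow_of_exponent_ge hZ0 hZ1 ?_
      push_cast [hs2']
      rw [div_mul_eq_mul_div, div_le_iff₀ hq]
      nlinarith
  have h1 := h (W * Z ^ ((s : ℝ) / q)) e (by positivity) he
  rw [Real.mul_rpow hW (by positivity), Real.mul_rpow hW (by positivity),
    ← Real.rpow_mul hZ _ q, div_mul_cancel₀ _ hq.ne', Real.rpow_natCast] at h1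
  refine le_trans ?_ h1
  calc W ^ p * e ^ (q - p) * Z ^ (s - 2)
      ≤ W ^ p * e ^ (q - p) * (Z ^ ((s : ℝ) / q)) ^ p := by gcongr
    _ = _ := by ring

/-! ### Classical derivatives -/

section Derivatives

variable {n : ℕ} {f g : SpaceTime n → ℝ} {p : SpaceTime n}

lemma timeDeriv_congr (h : f =ᶠ[𝓝 p] g) : timeDeriv f p = timeDeriv g p := by
  simp only [timeDeriv, h.fderiv_eq]

lemma spaceGrad_congr (h : f =ᶠ[𝓝 p] g) : spaceGrad f p = spaceGrad g p := by
  simp only [spaceGrad, h.fderiv_eq]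

lemma timeDeriv_const (c : ℝ) : timeDeriv (fun _ : SpaceTime n => c) p = 0 := by
  simp [timeDeriv]

lemma spaceGrad_const (c : ℝ) : spaceGrad (fun _ : SpaceTime n => c) p = 0 := by
  ext i; simp [spaceGrad]

lemma timeDeriv_sub (hf : DifferentiableAt ℝ f p) (hg : DifferentiableAt ℝ g p) :
    timeDeriv (fun x => f x - g x) p = timeDeriv f p - timeDeriv g p := by
  simp [timeDeriv, fderiv_fun_sub hf hg]

lemma spaceGrad_sub (hf : DifferentiableAt ℝ f p) (hg : DifferentiableAt ℝ g p) :
    spaceGrad (fun x => f x - g x) p = spaceGrad f p - spaceGrad g p := by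
  ext i; simp [spaceGrad, fderiv_fun_sub hf hg]

lemma timeDeriv_mul (hf : DifferentiableAt ℝ f p) (hg : DifferentiableAt ℝ g p) :
    timeDeriv (fun x => f x * g x) p = f p * timeDeriv g p + g p * timeDeriv f p := by
  simp [timeDeriv, fderiv_fun_mul hf hg]

lemma spaceGrad_mul (hf : DifferentiableAt ℝ f p) (hg : DifferentiableAt ℝ g p) :
    spaceGrad (fun x => f x * g x) p = f p • spaceGrad g p + g p • spaceGrad f p := by
  ext i; simp [spaceGrad, fderiv_fun_mul hf hg]

lemma timeDeriv_comp {h : ℝ → ℝ} {h' : ℝ} (hh : HasDerivAt h h' (f p))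
    (hf : DifferentiableAt ℝ f p) : timeDeriv (fun x => h (f x)) p = h' * timeDeriv f p := by
  have := (hh.comp_hasFDerivAt p hf.hasFDerivAt).fderiv
  simp only [Function.comp_def] at this
  simp [timeDeriv, this]

lemma spaceGrad_comp {h : ℝ → ℝ} {h' : ℝ} (hh : HasDerivAt h h' (f p))
    (hf : DifferentiableAt ℝ f p) : spaceGrad (fun x => h (f x)) p = h' • spaceGrad f p := by
  have := (hh.comp_hasFDerivAt p hf.hasFDerivAt).fderiv
  simp only [Function.comp_def] at this
  ext i; simp [spaceGrad, this]

lemma continuous_timeDeriv (hf : ContDiff ℝ ∞ f) : Continuous (timeDeriv f) :=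
  (hf.continuous_fderiv (by simp)).clm_apply continuous_const

lemma continuous_spaceGrad (hf : ContDiff ℝ ∞ f) : Continuous (spaceGrad f) :=
  (PiLp.continuous_toLp 2 _).comp <| continuous_pi fun _ =>
    (hf.continuous_fderiv (by simp)).clm_apply continuous_const

lemma timeDeriv_eq_zero_of_notMem (hp : p ∉ tsupport f) : timeDeriv f p = 0 := by
  rw [timeDeriv_congr (notMem_tsupport_iff_eventuallyEq.1 hp)]
  exact timeDeriv_const 0

lemma spaceGrad_eq_zero_of_notMem (hp : p ∉ tsupport f) : spaceGrad f p = 0 := by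
  rw [spaceGrad_congr (notMem_tsupport_iff_eventuallyEq.1 hp)]
  exact spaceGrad_const 0

lemma hasCompactSupport_timeDeriv (hf : HasCompactSupport f) :
    HasCompactSupport (timeDeriv f) :=
  hf.mono' fun _ hp => by_contra fun h => hp (timeDeriv_eq_zero_of_notMem h)

lemma hasCompactSupport_spaceGrad (hf : HasCompactSupport f) :
    HasCompactSupport (spaceGrad f) :=
  hf.mono' fun _ hp => by_contra fun h => hp (spaceGrad_eq_zero_of_notMem h)

lemma integral_timeDeriv_eq_zero (hf : ContDiff ℝ ∞ f) (hc : HasCompactSupport f) :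
    ∫ p, timeDeriv f p = 0 := by
  have hd : Differentiable ℝ f := hf.differentiable (by simp)
  have : (volume : Measure (SpaceTime n)).IsAddHaarMeasure :=
    Measure.prod.instIsAddHaarMeasure _ _
  have hi : Integrable (fun p => fderiv ℝ f p (1, 0)) :=
    (continuous_timeDeriv hf).integrable_of_hasCompactSupport (hasCompactSupport_timeDeriv hc)
  have hi' : Integrable f := hf.continuous.integrable_of_hasCompactSupport hc
  have h := integral_mul_fderiv_eq_neg_fderiv_mul_of_integrable (μ := volume)
    (f := fun _ : SpaceTime n => (1 : ℝ)) (g := f) (v := ((1 : ℝ), (0 : EuclideanSpace ℝ (Fin n))))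
    (by simp) (by simpa using hi) (by simpa using hi')
    (fun x _ => differentiableAt_const _) (fun x _ => hd x)
  simpa [timeDeriv] using h

end Derivatives

/-! ### Local regularity and smooth approximation -/

/-- The local information carried by `W^{𝓛,q}`: the three components are integrable on `B` to the
proper powers, and `(w, s, G)` is approximated on `B` by functions that are smooth on the whole
space-time. The `L^q` convergence is weakened to `L¹` convergence. -/
structure SobolevOn {n : ℕ} (a : SpaceTime n → Matrix (Fin n) (Fin n) ℝ) (q : ℝ)
    (B : Set (SpaceTime n)) (w s : SpaceTime n → ℝ)
    (G : SpaceTime n → EuclideanSpace ℝ (Fin n)) : Prop where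
  memLp : MemLp w (ENNReal.ofReal q) (volume.restrict B)
  integrable_timeDeriv : IntegrableOn s B
  aemeasurable_grad : AEMeasurable G (volume.restrict B)
  integrable_form : IntegrableOn (fun p => bilin (a p) (G p) (G p)) B
  approx : ∃ F : ℕ → SpaceTime n → ℝ, (∀ k, ContDiff ℝ ∞ (F k)) ∧
    Tendsto (fun k => ∫⁻ p in B, ‖F k p - w p‖ₑ) atTop (𝓝 0) ∧
    Tendsto (fun k => ∫⁻ p in B, ‖timeDeriv (F k) p - s p‖ₑ) atTop (𝓝 0) ∧
    Tendsto (fun k => ∫⁻ p in B, ‖bilin (a p) (spaceGrad (F k) p - G p)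
      (spaceGrad (F k) p - G p)‖ₑ) atTop (𝓝 0)

section Sobolev

variable {n : ℕ} {a : SpaceTime n → Matrix (Fin n) (Fin n) ℝ} {A : SpaceTime n → ℝ} {q : ℝ}

lemma tendsto_zero_of_rpow {x : ℕ → ℝ≥0∞} {r : ℝ} (hr : 0 < r)
    (h : Tendsto (fun k => x k ^ r) atTop (𝓝 0)) : Tendsto x atTop (𝓝 0) := by
  have h2 := (ENNReal.continuous_rpow_const (y := 1 / r)).tendsto _ |>.comp h
  simp only [Function.comp_def, ← ENNReal.rpow_mul, mul_one_div_cancel hr.ne', ENNReal.rpow_one,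
    ENNReal.zero_rpow_of_pos (one_div_pos.2 hr)] at h2
  exact h2

/-- A smooth compactly supported function has finite energy. -/
lemma IsCoefficient.integrable_bilin_spaceGrad (ha : IsCoefficient a A) {f : SpaceTime n → ℝ}
    (hf : ContDiff ℝ ∞ f) (hc : HasCompactSupport f) :
    Integrable (fun p => bilin (a p) (spaceGrad f p) (spaceGrad f p)) := by
  obtain ⟨M, hM⟩ := ha.locallyBounded_bound (tsupport f) hc
  have hg := continuous_spaceGrad hf
  have hi : Integrable (fun p => M * ‖spaceGrad f p‖ ^ 2) := by
    refine Continuous.integrable_of_hasCompactSupport (by fun_prop) ?_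
    refine (hasCompactSupport_spaceGrad hc).mono' fun p hp => subset_tsupport _ fun h => hp ?_
    simp [h]
  refine hi.mono' (ha.aemeasurable_bilin .rfl hg.measurable.aemeasurable
    hg.measurable.aemeasurable).aestronglyMeasurable ?_
  filter_upwards [ha.form_nonneg, ha.form_le] with p h1 h2
  rw [Real.norm_of_nonneg (h1 _)]
  refine (h2 _).trans ?_
  by_cases hp : p ∈ tsupport f
  · exact mul_le_mul_of_nonneg_right ((le_abs_self _).trans (hM p hp)) (by positivity)
  · simp [spaceGrad_eq_zero_of_notMem hp]

lemma MemWLoc.sobolevOn {w s : SpaceTime n → ℝ} {G : SpaceTime n → EuclideanSpace ℝ (Fin n)}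
    (hq : 1 < q) (ha : IsCoefficient a A) (hw : MemWLoc a q w s G) {ρ : ℝ} (hρ : 0 < ρ) :
    SobolevOn a q (Metric.ball 0 ρ) w s G := by
  set B : Set (SpaceTime n) := Metric.ball 0 ρ with hB
  set Ω : Set (SpaceTime n) := Metric.ball 0 (ρ + 2) with hΩ
  have hq0 : 0 < q := by linarith
  have hBΩ : B ⊆ Ω := Metric.ball_subset_ball (by linarith)
  obtain ⟨f, hf, -, hlim⟩ := hw.memW Ω Metric.isOpen_ball
    ((convex_ball _ _).isConnected ⟨0, Metric.mem_ball_self (by linarith)⟩) Metric.isBounded_ball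
  let χ : ContDiffBump (0 : SpaceTime n) := ⟨ρ, ρ + 1, hρ, by linarith⟩
  let F : ℕ → SpaceTime n → ℝ := fun k p => χ p * f k p
  have hFc : ∀ k, HasCompactSupport (F k) := fun k => χ.hasCompactSupport.mul_right
  have hF : ∀ k, ContDiff ℝ ∞ (F k) := by
    intro k
    rw [contDiff_iff_contDiffAt]
    intro p
    by_cases hp : p ∈ Ω
    · exact χ.contDiffAt.mul ((hf k).contDiffAt (Metric.isOpen_ball.mem_nhds hp))
    · have hp' : p ∉ tsupport χ := by
        rw [χ.tsupport_eq]
        intro h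
        exact hp (Metric.closedBall_subset_ball (by change ρ + 1 < ρ + 2; linarith) h)
      refine contDiffAt_const (c := (0 : ℝ)) |>.congr_of_eventuallyEq ?_
      filter_upwards [notMem_tsupport_iff_eventuallyEq.1 hp'] with x hx
      simp [F, hx]
  have hFf : ∀ k, ∀ p ∈ B, F k =ᶠ[𝓝 p] f k := by
    intro k p hp
    filter_upwards [Metric.isOpen_ball.mem_nhds hp] with x hx
    simp [F, χ.one_of_mem_closedBall (Metric.ball_subset_closedBall hx)]
  have hBm : MeasurableSet B := measurableSet_ball
  have hBfin : volume B ≠ ⊤ := measure_ball_lt_top.ne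
  have hwm : AEMeasurable w (volume.restrict B) := hw.aemeasurable.restrict
  have hsm : AEMeasurable s (volume.restrict B) := hw.aemeasurable_timeDeriv.restrict
  have hGm : AEMeasurable G (volume.restrict B) := hw.aemeasurable_grad.restrict
  have hmax : max 1 q = q := max_eq_right hq.le
  have hle : ∀ {x y z : ℕ → ℝ≥0∞}, Tendsto x atTop (𝓝 0) → (∀ k, z k ≤ x k) →
      Tendsto z atTop (𝓝 0) := fun hx h =>
    tendsto_of_tendsto_of_tendsto_of_le_of_le tendsto_const_nhds hx (fun _ => zero_le) h
  have htime : Tendsto (fun k => ∫⁻ p in B, ‖timeDeriv (F k) p - s p‖ₑ) atTop (𝓝 0) := by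
    refine hle (y := 0) hlim fun k => ?_
    refine le_trans ?_ (le_self_add.trans le_self_add)
    calc ∫⁻ p in B, ‖timeDeriv (F k) p - s p‖ₑ
        = ∫⁻ p in B, ENNReal.ofReal |timeDeriv (f k) p - s p| := by
          refine setLIntegral_congr_fun hBm fun p hp => ?_
          simp only [timeDeriv_congr (hFf k p hp), Real.enorm_eq_ofReal_abs]
      _ ≤ _ := lintegral_mono_set hBΩ
  have hgrad : Tendsto (fun k => ∫⁻ p in B, ‖bilin (a p) (spaceGrad (F k) p - G p)
      (spaceGrad (F k) p - G p)‖ₑ) atTop (𝓝 0) := by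
    refine tendsto_zero_of_rpow (r := 1 / 2) (by norm_num) (hle (y := 0) hlim fun k => ?_)
    refine le_trans ?_ (le_add_self.trans le_self_add)
    refine ENNReal.rpow_le_rpow ?_ (by norm_num)
    calc ∫⁻ p in B, ‖bilin (a p) (spaceGrad (F k) p - G p) (spaceGrad (F k) p - G p)‖ₑ
        = ∫⁻ p in B, ENNReal.ofReal (bilin (a p) (spaceGrad (f k) p - G p)
            (spaceGrad (f k) p - G p)) := by
          refine lintegral_congr_ae ?_
          filter_upwards [ae_restrict_mem hBm, ae_restrict_of_ae ha.form_nonneg] with p hp h0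
          rw [Real.enorm_of_nonneg (h0 _), spaceGrad_congr (hFf k p hp)]
      _ ≤ _ := lintegral_mono_set hBΩ
  have hLq : Tendsto (fun k => eLpNorm (fun p => F k p - w p) (ENNReal.ofReal q)
      (volume.restrict B)) atTop (𝓝 0) := by
    refine hle (y := 0) hlim fun k => ?_
    refine le_trans ?_ le_add_self
    rw [eLpNorm_eq_lintegral_rpow_enorm_toReal (by simpa using hq0) ENNReal.ofReal_ne_top,
      ENNReal.toReal_ofReal hq0.le, hmax]
    refine ENNReal.rpow_le_rpow ?_ (by positivity)
    calc ∫⁻ p in B, ‖F k p - w p‖ₑ ^ q = ∫⁻ p in B, ENNReal.ofReal (|f k p - w p| ^ q) := by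
          refine setLIntegral_congr_fun hBm fun p hp => ?_
          simp only [(hFf k p hp).eq_of_nhds, Real.enorm_eq_ofReal_abs]
          rw [ENNReal.ofReal_rpow_of_nonneg (abs_nonneg _) hq0.le]
      _ ≤ _ := lintegral_mono_set hBΩ
  have hFw : ∀ k, AEStronglyMeasurable (fun p => F k p - w p) (volume.restrict B) := fun k =>
    (hF k).continuous.aestronglyMeasurable.sub hwm.aestronglyMeasurable
  have hL1 : Tendsto (fun k => ∫⁻ p in B, ‖F k p - w p‖ₑ) atTop (𝓝 0) := by
    have h1 : (1 : ℝ≥0∞) ≤ ENNReal.ofReal q := by simpa using ENNReal.ofReal_le_ofReal hq.le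
    set c : ℝ≥0∞ := (volume.restrict B) Set.univ ^
      (1 / (1 : ℝ≥0∞).toReal - 1 / (ENNReal.ofReal q).toReal) with hc
    have hc' : c ≠ ⊤ := by
      refine ENNReal.rpow_ne_top_of_nonneg ?_ (by simpa using hBfin)
      rw [ENNReal.toReal_ofReal hq0.le, ENNReal.toReal_one, sub_nonneg]
      exact one_div_le_one_div_of_le one_pos hq.le
    have h2 := ENNReal.Tendsto.mul_const (b := c) hLq (Or.inr hc')
    rw [zero_mul] at h2
    refine hle (y := 0) h2 fun k => ?_
    rw [← eLpNorm_one_eq_lintegral_enorm]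
    exact eLpNorm_le_eLpNorm_mul_rpow_measure_univ h1 (hFw k)
  refine ⟨?_, ?_, hGm, ?_, F, hF, hL1, htime, hgrad⟩
  · obtain ⟨k, hk⟩ := (hLq.eventually (gt_mem_nhds (zero_lt_one))).exists
    have h1 : MemLp (fun p => F k p - w p) (ENNReal.ofReal q) (volume.restrict B) :=
      ⟨hFw k, hk.trans ENNReal.one_lt_top⟩
    have h2 : MemLp (F k) (ENNReal.ofReal q) (volume.restrict B) :=
      ((hF k).continuous.memLp_of_hasCompactSupport (hFc k)).restrict B
    have h3 := h2.sub h1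
    refine h3.ae_eq (ae_of_all _ fun p => ?_)
    simp
  · obtain ⟨k, hk⟩ := (htime.eventually (gt_mem_nhds (zero_lt_one))).exists
    have hct := continuous_timeDeriv (hF k)
    have h1 : IntegrableOn (fun p => timeDeriv (F k) p - s p) B :=
      ⟨hct.aestronglyMeasurable.sub hsm.aestronglyMeasurable, hk.trans ENNReal.one_lt_top⟩
    have h2 : IntegrableOn (timeDeriv (F k)) B :=
      (hct.integrable_of_hasCompactSupport (hasCompactSupport_timeDeriv (hFc k))).integrableOn
    refine (h2.sub h1).congr (ae_of_all _ fun p => ?_)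
    simp
  · obtain ⟨k, hk⟩ := (hgrad.eventually (gt_mem_nhds (zero_lt_one))).exists
    have hcg : AEMeasurable (spaceGrad (F k)) (volume.restrict B) :=
      (continuous_spaceGrad (hF k)).measurable.aemeasurable
    have hac : (volume.restrict B : Measure (SpaceTime n)) ≪ volume :=
      Measure.absolutelyContinuous_of_le Measure.restrict_le_self
    have h1 : IntegrableOn (fun p => bilin (a p) (spaceGrad (F k) p - G p)
        (spaceGrad (F k) p - G p)) B :=
      ⟨(ha.aemeasurable_bilin hac (hcg.sub hGm) (hcg.sub hGm)).aestronglyMeasurable,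
        hk.trans ENNReal.one_lt_top⟩
    have h2 := (ha.integrable_bilin_spaceGrad (hF k) (hFc k)).integrableOn (s := B)
    refine ((h2.const_mul 2).add (h1.const_mul 2)).mono'
      (ha.aemeasurable_bilin hac hGm hGm).aestronglyMeasurable ?_
    filter_upwards [ae_restrict_of_ae ha.isPosSemidefForm] with p hp
    rw [Real.norm_of_nonneg (hp.nonneg _)]
    have := hp.sub_le (spaceGrad (F k) p) (spaceGrad (F k) p - G p)
    rwa [sub_sub_cancel] at this

lemma SobolevOn.sub (ha : IsCoefficient a A) {B : Set (SpaceTime n)}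
    {w s w' s' : SpaceTime n → ℝ} {G G' : SpaceTime n → EuclideanSpace ℝ (Fin n)}
    (h : SobolevOn a q B w s G) (h' : SobolevOn a q B w' s' G') :
    SobolevOn a q B (fun p => w p - w' p) (fun p => s p - s' p) (fun p => G p - G' p) := by
  have hac : (volume.restrict B : Measure (SpaceTime n)) ≪ volume :=
    Measure.absolutelyContinuous_of_le Measure.restrict_le_self
  have hGm := h.aemeasurable_grad.sub h'.aemeasurable_grad
  have hpsd : ∀ᵐ p ∂volume.restrict B, IsPosSemidefForm (a p) :=
    ae_restrict_of_ae ha.isPosSemidefForm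
  obtain ⟨F, hF, h1, h2, h3⟩ := h.approx
  obtain ⟨F', hF', h1', h2', h3'⟩ := h'.approx
  have hd : ∀ k, Differentiable ℝ (F k) := fun k => (hF k).differentiable (by simp)
  have hd' : ∀ k, Differentiable ℝ (F' k) := fun k => (hF' k).differentiable (by simp)
  have hle : ∀ {x y : ℕ → ℝ≥0∞}, Tendsto x atTop (𝓝 0) → (∀ k, y k ≤ x k) →
      Tendsto y atTop (𝓝 0) := fun hx h =>
    tendsto_of_tendsto_of_tendsto_of_le_of_le tendsto_const_nhds hx (fun _ => zero_le) h
  refine ⟨h.memLp.sub h'.memLp, h.integrable_timeDeriv.sub h'.integrable_timeDeriv, hGm, ?_,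
    fun k p => F k p - F' k p, fun k => (hF k).sub (hF' k), ?_, ?_, ?_⟩
  · refine ((h.integrable_form.const_mul 2).add (h'.integrable_form.const_mul 2)).mono'
      (ha.aemeasurable_bilin hac hGm hGm).aestronglyMeasurable ?_
    filter_upwards [hpsd] with p hp
    rw [Real.norm_of_nonneg (hp.nonneg _)]
    exact hp.sub_le _ _
  · have hs := h1.add h1'
    rw [add_zero] at hs
    refine hle hs fun k => ?_
    have hm : AEMeasurable (fun p => F k p - w p) (volume.restrict B) :=
      (hF k).continuous.aemeasurable.sub h.memLp.1.aemeasurable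
    rw [← lintegral_add_left' hm.enorm]
    refine lintegral_mono fun p => ?_
    rw [show F k p - F' k p - (w p - w' p) = (F k p - w p) - (F' k p - w' p) by ring]
    exact enorm_sub_le
  · have hs := h2.add h2'
    rw [add_zero] at hs
    refine hle hs fun k => ?_
    have hm : AEMeasurable (fun p => timeDeriv (F k) p - s p) (volume.restrict B) :=
      (continuous_timeDeriv (hF k)).aemeasurable.sub h.integrable_timeDeriv.1.aemeasurable
    rw [← lintegral_add_left' hm.enorm]
    refine lintegral_mono fun p => ?_
    rw [timeDeriv_sub (hd k p) (hd' k p), sub_sub_sub_comm]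
    exact enorm_sub_le
  · have hs := (ENNReal.Tendsto.const_mul (a := 2) h3 (Or.inr (by simp))).add
      (ENNReal.Tendsto.const_mul (a := 2) h3' (Or.inr (by simp)))
    rw [mul_zero, add_zero] at hs
    refine hle hs fun k => ?_
    have hg : AEMeasurable (fun p => spaceGrad (F k) p - G p) (volume.restrict B) :=
      (continuous_spaceGrad (hF k)).measurable.aemeasurable.sub h.aemeasurable_grad
    have h2r : ∀ x : ℝ, 2 * ENNReal.ofReal x = ENNReal.ofReal (2 * x) := fun x => by
      rw [ENNReal.ofReal_mul zero_le_two, ENNReal.ofReal_ofNat]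
    rw [← lintegral_const_mul' _ _ (by simp), ← lintegral_const_mul' _ _ (by simp),
      ← lintegral_add_left' ((ha.aemeasurable_bilin hac hg hg).enorm.const_mul 2)]
    refine lintegral_mono_ae ?_
    filter_upwards [hpsd] with p hp
    rw [spaceGrad_sub (hd k p) (hd' k p), sub_sub_sub_comm, Real.enorm_of_nonneg (hp.nonneg _),
      Real.enorm_of_nonneg (hp.nonneg _), Real.enorm_of_nonneg (hp.nonneg _), h2r, h2r,
      ← ENNReal.ofReal_add (mul_nonneg zero_le_two (hp.nonneg _))
        (mul_nonneg zero_le_two (hp.nonneg _))]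
    exact ENNReal.ofReal_le_ofReal (hp.sub_le _ _)

end Sobolev

/-! ### Testing with functions of the solution -/

/-- If `m k → m'` boundedly and almost everywhere and `f k → f'` in `L¹`, then
`m k * f k → m' * f'` in the sense of integrals. -/
lemma tendsto_integral_bdd_mul {X : Type*} [MeasurableSpace X] {μ : Measure X}
    {m : ℕ → X → ℝ} {m' : X → ℝ} {f : ℕ → X → ℝ} {f' : X → ℝ} {M : ℝ}
    (hm : ∀ k, AEStronglyMeasurable (m k) μ) (hM : ∀ k x, |m k x| ≤ M)
    (hlim : ∀ᵐ x ∂μ, Tendsto (fun k => m k x) atTop (𝓝 (m' x)))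
    (hf : ∀ k, AEStronglyMeasurable (f k) μ) (hf' : Integrable f' μ)
    (hff : Tendsto (fun k => ∫⁻ x, ‖f k x - f' x‖ₑ ∂μ) atTop (𝓝 0)) :
    (∀ᶠ k in atTop, Integrable (fun x => m k x * f k x) μ) ∧
      Integrable (fun x => m' x * f' x) μ ∧
      Tendsto (fun k => ∫ x, m k x * f k x ∂μ) atTop (𝓝 (∫ x, m' x * f' x ∂μ)) := by
  have hev : ∀ᶠ k in atTop, Integrable (fun x => f k x - f' x) μ := by
    filter_upwards [hff.eventually (gt_mem_nhds zero_lt_one)] with k hk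
    exact ⟨(hf k).sub hf'.1, hk.trans ENNReal.one_lt_top⟩
  have hbd : ∀ k, ∀ g : X → ℝ, Integrable g μ → Integrable (fun x => m k x * g x) μ :=
    fun k g hg => hg.bdd_mul (hm k) (ae_of_all _ fun x => by simpa using hM k x)
  have hev' : ∀ᶠ k in atTop, Integrable (fun x => m k x * f k x) μ := by
    filter_upwards [hev] with k hk
    refine (hbd k _ (hk.add hf')).congr (ae_of_all _ fun x => ?_)
    simp
  have hm'm : AEStronglyMeasurable m' μ := aestronglyMeasurable_of_tendsto_ae _ hm hlim
  have hM' : ∀ᵐ x ∂μ, ‖m' x‖ ≤ M := by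
    filter_upwards [hlim] with x hx
    exact le_of_tendsto hx.norm (Eventually.of_forall fun k => by simpa using hM k x)
  refine ⟨hev', hf'.bdd_mul hm'm hM', ?_⟩
  have h1 : Tendsto (fun k => ∫ x, m k x * f' x ∂μ) atTop (𝓝 (∫ x, m' x * f' x ∂μ)) := by
    refine tendsto_integral_of_dominated_convergence (fun x => M * ‖f' x‖)
      (fun k => (hm k).mul hf'.1) (hf'.norm.const_mul M) (fun k => ae_of_all _ fun x => ?_) ?_
    · rw [norm_mul]
      exact mul_le_mul_of_nonneg_right (by simpa using hM k x) (norm_nonneg _)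
    · filter_upwards [hlim] with x hx using hx.mul_const _
  have h2 : Tendsto (fun k => ∫ x, m k x * (f k x - f' x) ∂μ) atTop (𝓝 0) := by
    have h3 := tendsto_integral_of_L1 (μ := μ) (fun _ => (0 : ℝ)) aestronglyMeasurable_const
      (F := fun k x => m k x * (f k x - f' x)) (l := atTop)
      (by filter_upwards [hev] with k hk using hbd k _ hk) ?_
    · simpa using h3
    · have h4 := ENNReal.Tendsto.const_mul (a := ENNReal.ofReal M) hff (Or.inr (by simp))
      rw [mul_zero] at h4
      refine tendsto_of_tendsto_of_tendsto_of_le_of_le tendsto_const_nhds h4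
        (fun _ => zero_le) fun k => ?_
      rw [← lintegral_const_mul' _ _ (by simp)]
      refine lintegral_mono fun x => ?_
      simp only [sub_zero, enorm_mul]
      gcongr
      rw [Real.enorm_eq_ofReal_abs]
      exact ENNReal.ofReal_le_ofReal (hM k x)
  have h3 := h1.add h2
  rw [add_zero] at h3
  refine h3.congr' ?_
  filter_upwards [hev] with k hk
  rw [← integral_add (hbd k _ hf') (hbd k _ hk)]
  exact integral_congr_ae (ae_of_all _ fun x => by ring)

lemma integral_add_add_sub_const_mul {X : Type*} [MeasurableSpace X] {μ : Measure X}
    {f g h k : X → ℝ} {c : ℝ} (hf : Integrable f μ) (hg : Integrable g μ) (hh : Integrable h μ)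
    (hk : Integrable k μ) : ∫ x, (f x + g x + h x - c * k x) ∂μ
      = (∫ x, f x ∂μ) + (∫ x, g x ∂μ) + (∫ x, h x ∂μ) - c * ∫ x, k x ∂μ := by
  have h1 : Integrable (fun x => f x + g x) μ := hf.add hg
  have h2 : Integrable (fun x => f x + g x + h x) μ := h1.add hh
  rw [integral_sub h2 (hk.const_mul c), integral_add h1 hh, integral_add hf hg,
    integral_const_mul]

section WeakInequality

variable {n : ℕ} {a : SpaceTime n → Matrix (Fin n) (Fin n) ℝ} {A : SpaceTime n → ℝ} {q κ : ℝ}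

lemma SobolevOn.integrableOn_bilin (ha : IsCoefficient a A) {B : Set (SpaceTime n)}
    {w s : SpaceTime n → ℝ} {G X : SpaceTime n → EuclideanSpace ℝ (Fin n)}
    (h : SobolevOn a q B w s G) (hX : AEMeasurable X (volume.restrict B))
    (hX' : IntegrableOn (fun p => bilin (a p) (X p) (X p)) B) :
    IntegrableOn (fun p => bilin (a p) (X p) (G p)) B := by
  refine ((h.integrable_form.const_mul (1 / 2)).add (hX'.div_const 2)).mono'
    (ha.aemeasurable_bilin (Measure.absolutelyContinuous_of_le Measure.restrict_le_self) hX
      h.aemeasurable_grad).aestronglyMeasurable ?_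
  filter_upwards [ae_restrict_of_ae ha.isPosSemidefForm] with p hp
  simpa using hp.abs_le_weighted one_pos (X p) (G p)

lemma SobolevOn.integrableOn_abs_rpow (hq : 1 < q) {B : Set (SpaceTime n)}
    {w s : SpaceTime n → ℝ} {G : SpaceTime n → EuclideanSpace ℝ (Fin n)}
    (h : SobolevOn a q B w s G) : IntegrableOn (fun p => |w p| ^ q) B := by
  have := h.memLp.integrable_norm_rpow (by simpa using by linarith) ENNReal.ofReal_ne_top
  rwa [ENNReal.toReal_ofReal (by linarith)] at this

lemma integrable_mul_of_bdd {B : Set (SpaceTime n)} {m f : SpaceTime n → ℝ} (hm : Continuous m)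
    (hc : HasCompactSupport m) (hB : tsupport m ⊆ B) (hf : IntegrableOn f B) :
    Integrable fun p => f p * m p := by
  obtain ⟨M, hM⟩ := hc.exists_bound_of_continuous hm
  have h := Integrable.mul_bdd (c := M) hf hm.aestronglyMeasurable (ae_of_all _ hM)
  refine IntegrableOn.integrable_of_forall_notMem_eq_zero h fun p hp => ?_
  rw [image_eq_zero_of_notMem_tsupport fun h => hp (hB h), mul_zero]

/-- The integrand of the weak formulation is integrable. -/
lemma integrable_weakForm (hq : 1 < q) (ha : IsCoefficient a A) {B : Set (SpaceTime n)}
    {w s : SpaceTime n → ℝ} {G : SpaceTime n → EuclideanSpace ℝ (Fin n)}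
    (h : SobolevOn a q B w s G) {φ : SpaceTime n → ℝ} (hφ : IsTest φ) (hB : tsupport φ ⊆ B) :
    Integrable (fun p => s p * φ p) ∧ Integrable (fun p => bilin (a p) (spaceGrad φ p) (G p)) ∧
      Integrable (fun p => |w p| ^ (q - 1) * w p * φ p) := by
  have hφc := hφ.smooth.continuous
  refine ⟨integrable_mul_of_bdd hφc hφ.compact hB h.integrable_timeDeriv, ?_, ?_⟩
  · have h1 := h.integrableOn_bilin ha (continuous_spaceGrad hφ.smooth).measurable.aemeasurable
      (ha.integrable_bilin_spaceGrad hφ.smooth hφ.compact).integrableOn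
    refine h1.integrable_of_forall_notMem_eq_zero fun p hp => ?_
    rw [spaceGrad_eq_zero_of_notMem fun h => hp (hB h)]
    simp [bilin]
  · refine integrable_mul_of_bdd hφc hφ.compact hB ?_
    refine (h.integrableOn_abs_rpow hq).mono' ?_ (ae_of_all _ fun p => ?_)
    · exact ((h.memLp.1.aemeasurable.norm.pow_const (q - 1)).mul
        h.memLp.1.aemeasurable).aestronglyMeasurable
    · rw [norm_mul, Real.norm_eq_abs, Real.norm_eq_abs, Real.abs_rpow_of_nonneg (abs_nonneg _),
        abs_abs]
      nth_rewrite 2 [← Real.rpow_one |w p|]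
      rw [← Real.rpow_add_of_nonneg (abs_nonneg _) (by linarith) zero_le_one, sub_add_cancel]

/-- `w ≥ 0` is a weak solution of `w_t ≥ 𝓛w + κ w^q`. -/
structure WeakInequality (a : SpaceTime n → Matrix (Fin n) (Fin n) ℝ) (q κ : ℝ)
    (w s : SpaceTime n → ℝ) (G : SpaceTime n → EuclideanSpace ℝ (Fin n)) : Prop where
  nonneg : ∀ᵐ p, 0 ≤ w p
  aemeasurable : AEMeasurable w volume
  sobolevOn : ∀ ρ : ℝ, 0 < ρ → SobolevOn a q (Metric.ball 0 ρ) w s G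
  ineq : ∀ φ, IsTest φ →
    0 ≤ ∫ p, (s p * φ p + bilin (a p) (spaceGrad φ p) (G p) - κ * |w p| ^ q * φ p)

lemma exists_tsupport_subset_ball {φ : SpaceTime n → ℝ} (hφ : HasCompactSupport φ) :
    ∃ ρ : ℝ, 0 < ρ ∧ tsupport φ ⊆ Metric.ball 0 ρ := by
  obtain ⟨r, hr⟩ := hφ.isBounded.subset_ball 0
  exact ⟨max r 1, by positivity, hr.trans (Metric.ball_subset_ball (le_max_left _ _))⟩

/-- The difference of a super- and a subsolution is a supersolution. -/
lemma exists_weakInequality (hq : 1 < q) (ha : IsCoefficient a A) {u v : SpaceTime n → ℝ}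
    (hu : IsWeakSupersolution a q u) (hv : IsWeakSubsolution a q v) (huv : ∀ᵐ p, v p ≤ u p) :
    ∃ s G, WeakInequality a q (2 ^ (1 - q)) (fun p => u p - v p) s G := by
  obtain ⟨s, G, hU, hu⟩ := hu
  obtain ⟨s', G', hV, hv⟩ := hv
  have hS : ∀ ρ : ℝ, 0 < ρ → SobolevOn a q (Metric.ball 0 ρ) (fun p => u p - v p)
      (fun p => s p - s' p) (fun p => G p - G' p) := fun ρ hρ =>
    (hU.sobolevOn hq ha hρ).sub ha (hV.sobolevOn hq ha hρ)
  refine ⟨fun p => s p - s' p, fun p => G p - G' p, ?_, hU.aemeasurable.sub hV.aemeasurable,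
    hS, fun φ hφ => ?_⟩
  · filter_upwards [huv] with p hp using sub_nonneg.2 hp
  obtain ⟨ρ, hρ, hB⟩ := exists_tsupport_subset_ball hφ.compact
  obtain ⟨h1, h2, h3⟩ := integrable_weakForm hq ha (hU.sobolevOn hq ha hρ) hφ hB
  obtain ⟨h1', h2', h3'⟩ := integrable_weakForm hq ha (hV.sobolevOn hq ha hρ) hφ hB
  obtain ⟨h1'', h2'', -⟩ := integrable_weakForm hq ha (hS ρ hρ) hφ hB
  have h4 := integrable_mul_of_bdd hφ.smooth.continuous hφ.compact hB
    (((hS ρ hρ).integrableOn_abs_rpow hq).const_mul (2 ^ (1 - q)))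
  have hw := sub_nonneg.2 ((hv φ hφ).trans (hu φ hφ))
  unfold weakForm at hw
  have hi : Integrable (fun p => s p * φ p + bilin (a p) (spaceGrad φ p) (G p)
      - |u p| ^ (q - 1) * u p * φ p) := (h1.add h2).sub h3
  have hi' : Integrable (fun p => s' p * φ p + bilin (a p) (spaceGrad φ p) (G' p)
      - |v p| ^ (q - 1) * v p * φ p) := (h1'.add h2').sub h3'
  rw [← integral_sub hi hi'] at hw
  refine hw.trans (integral_mono_ae (hi.sub hi') ((h1''.add h2'').sub h4) ?_)
  filter_upwards [huv] with p hp
  have h5 := rpow_sub_le_signed_rpow_sub hq.le hp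
  have h6 := mul_le_mul_of_nonneg_right h5 (hφ.nonneg p)
  simp only [bilin_sub_right, abs_of_nonneg (sub_nonneg.2 hp)]
  linarith

/-- Testing with `h(w) ζ`: the test function is not smooth, but it is the limit of the test
functions `h(F k) ζ` for smooth `F k → w`. The time derivative is integrated by parts, with a
primitive `H` of `h`. -/
lemma WeakInequality.test_comp (hq : 1 < q) (ha : IsCoefficient a A) {w s : SpaceTime n → ℝ}
    {G : SpaceTime n → EuclideanSpace ℝ (Fin n)} (hw : WeakInequality a q κ w s G)
    {H h h' : ℝ → ℝ} {M : ℝ} (hh : ContDiff ℝ ∞ h) (hH : ∀ x, HasDerivAt H (h x) x)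
    (hh' : ∀ x, HasDerivAt h (h' x) x) (h0 : ∀ x, 0 ≤ h x) (hM : ∀ x, h x ≤ M)
    (hM' : ∀ x, |h' x| ≤ M) {ζ : SpaceTime n → ℝ} (hζ : IsTest ζ) :
    Integrable (fun p => -(H (w p) * timeDeriv ζ p)
      + h' (w p) * ζ p * bilin (a p) (G p) (G p)
      + h (w p) * bilin (a p) (spaceGrad ζ p) (G p) - κ * (h (w p) * ζ p * |w p| ^ q)) ∧
    0 ≤ ∫ p, (-(H (w p) * timeDeriv ζ p)
      + h' (w p) * ζ p * bilin (a p) (G p) (G p)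
      + h (w p) * bilin (a p) (spaceGrad ζ p) (G p) - κ * (h (w p) * ζ p * |w p| ^ q)) := by
  obtain ⟨ρ, hρ, hBζ⟩ := exists_tsupport_subset_ball hζ.compact
  set B : Set (SpaceTime n) := Metric.ball 0 ρ with hB
  have hS := hw.sobolevOn ρ hρ
  set μ : Measure (SpaceTime n) := volume.restrict B with hμ
  have : IsFiniteMeasure μ := ⟨by simpa [hμ] using measure_ball_lt_top⟩
  have hac : μ ≪ volume := Measure.absolutelyContinuous_of_le Measure.restrict_le_self
  have hpsd : ∀ᵐ p ∂μ, IsPosSemidefForm (a p) := ae_restrict_of_ae ha.isPosSemidefForm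
  have hwm : AEStronglyMeasurable w μ := hS.memLp.1
  have hGm := hS.aemeasurable_grad
  -- a subsequence of the approximations converges almost everywhere
  obtain ⟨F₀, hF₀, h₀1, h₀2, h₀3⟩ := hS.approx
  have hmeas : TendstoInMeasure μ F₀ atTop w := by
    refine tendstoInMeasure_of_tendsto_eLpNorm one_ne_zero
      (fun k => (hF₀ k).continuous.aestronglyMeasurable) hwm ?_
    simpa only [eLpNorm_one_eq_lintegral_enorm, Pi.sub_apply] using h₀1
  obtain ⟨ns, hns, hFlim⟩ := hmeas.exists_seq_tendsto_ae
  set F : ℕ → SpaceTime n → ℝ := fun k => F₀ (ns k) with hFdef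
  have hF : ∀ k, ContDiff ℝ ∞ (F k) := fun k => hF₀ _
  have h1 := h₀1.comp hns.tendsto_atTop
  have h2 := h₀2.comp hns.tendsto_atTop
  have h3 := h₀3.comp hns.tendsto_atTop
  simp only [Function.comp_def] at h1 h2 h3
  have hFd : ∀ k, Differentiable ℝ (F k) := fun k => (hF k).differentiable (by simp)
  have hζd : Differentiable ℝ ζ := hζ.smooth.differentiable (by simp)
  have hζc := hζ.smooth.continuous
  have hhc : Continuous h := hh.continuous
  have hh'c : Continuous h' := by
    have : h' = deriv h := funext fun x => (hh' x).deriv.symm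
    rw [this]
    exact hh.continuous_deriv (by simp)
  have hHd : Differentiable ℝ H := fun x => (hH x).differentiableAt
  have hHs : ContDiff ℝ ∞ H := by
    refine contDiff_infty_iff_deriv.2 ⟨hHd, ?_⟩
    rwa [show deriv H = h from funext fun x => (hH x).deriv]
  have hHlip : ∀ x y, |H x - H y| ≤ M * |x - y| := fun x y => by
    have := (convex_univ (𝕜 := ℝ) (E := ℝ)).norm_image_sub_le_of_norm_hasDerivWithin_le
      (f := H) (f' := h) (C := M) (fun x _ => (hH x).hasDerivWithinAt)
      (fun x _ => by rw [Real.norm_of_nonneg (h0 x)]; exact hM x) (Set.mem_univ y) (Set.mem_univ x)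
    simpa using this
  obtain ⟨Mζ, hMζ⟩ := hζ.compact.exists_bound_of_continuous hζc
  have hζt := continuous_timeDeriv hζ.smooth
  obtain ⟨Mt, hMt⟩ := (hasCompactSupport_timeDeriv hζ.compact).exists_bound_of_continuous hζt
  have hM0 : 0 ≤ M := (h0 0).trans (hM 0)
  -- the multipliers
  have hm1 : ∀ k p, |h (F k p) * ζ p| ≤ M * Mζ := fun k p => by
    rw [abs_mul, abs_of_nonneg (h0 _)]
    exact mul_le_mul (hM _) (hMζ p) (abs_nonneg _) hM0
  have hm2 : ∀ k p, |h' (F k p) * ζ p| ≤ M * Mζ := fun k p => by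
    rw [abs_mul]
    exact mul_le_mul (hM' _) (hMζ p) (abs_nonneg _) hM0
  have hm3 : ∀ k p, |h (F k p)| ≤ M := fun k p => by
    rw [abs_of_nonneg (h0 _)]; exact hM _
  have hFc : ∀ k, Continuous (F k) := fun k => (hF k).continuous
  have c1 : ∀ k, AEStronglyMeasurable (fun p => h (F k p) * ζ p) μ := fun k =>
    ((hhc.comp (hFc k)).mul hζc).aestronglyMeasurable
  have c2 : ∀ k, AEStronglyMeasurable (fun p => h' (F k p) * ζ p) μ := fun k =>
    ((hh'c.comp (hFc k)).mul hζc).aestronglyMeasurable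
  have c3 : ∀ k, AEStronglyMeasurable (fun p => h (F k p)) μ := fun k =>
    (hhc.comp (hFc k)).aestronglyMeasurable
  have l1 : ∀ᵐ p ∂μ, Tendsto (fun k => h (F k p) * ζ p) atTop (𝓝 (h (w p) * ζ p)) := by
    filter_upwards [hFlim] with p hp using ((hhc.tendsto _).comp hp).mul_const _
  have l2 : ∀ᵐ p ∂μ, Tendsto (fun k => h' (F k p) * ζ p) atTop (𝓝 (h' (w p) * ζ p)) := by
    filter_upwards [hFlim] with p hp using ((hh'c.tendsto _).comp hp).mul_const _
  have l3 : ∀ᵐ p ∂μ, Tendsto (fun k => h (F k p)) atTop (𝓝 (h (w p))) := by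
    filter_upwards [hFlim] with p hp using (hhc.tendsto _).comp hp
  have hconst : ∀ f : SpaceTime n → ℝ,
      Tendsto (fun _ : ℕ => ∫⁻ p, ‖f p - f p‖ₑ ∂μ) atTop (𝓝 0) := fun f => by simp
  -- convergence of `a(∇F k, G)` to `a(G, G)` by the Cauchy-Schwarz inequality
  have hgm : ∀ k, AEMeasurable (spaceGrad (F k)) μ := fun k =>
    (continuous_spaceGrad (hF k)).measurable.aemeasurable
  have hform : Tendsto (fun k => ∫⁻ p, ‖bilin (a p) (spaceGrad (F k) p) (G p)
      - bilin (a p) (G p) (G p)‖ₑ ∂μ) atTop (𝓝 0) := by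
    have hfin : (∫⁻ p, ‖bilin (a p) (G p) (G p)‖ₑ ∂μ) ^ (1 / 2 : ℝ) ≠ ⊤ :=
      ENNReal.rpow_ne_top_of_nonneg (by norm_num) hS.integrable_form.2.ne
    have h4 := ENNReal.Tendsto.mul_const
      ((ENNReal.continuous_rpow_const (y := (1 / 2 : ℝ))).tendsto _ |>.comp h3) (Or.inr hfin)
    rw [ENNReal.zero_rpow_of_pos (by norm_num), zero_mul] at h4
    refine tendsto_of_tendsto_of_tendsto_of_le_of_le tendsto_const_nhds h4
      (fun _ => zero_le) fun k => ?_
    have hd : AEMeasurable (fun p => spaceGrad (F k) p - G p) μ := (hgm k).sub hGm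
    have hsq : ∀ x : ℝ≥0∞, (x ^ (1 / 2 : ℝ)) ^ (2 : ℝ) = x := fun x => by
      rw [← ENNReal.rpow_mul]; norm_num
    have h5 := ENNReal.lintegral_mul_le_Lp_mul_Lq μ Real.HolderConjugate.two_two
      ((ha.aemeasurable_bilin hac hd hd).enorm.pow_const (1 / 2 : ℝ))
      ((ha.aemeasurable_bilin hac hGm hGm).enorm.pow_const (1 / 2 : ℝ))
    simp only [hsq] at h5
    refine le_trans (lintegral_mono_ae ?_) h5
    filter_upwards [hpsd] with p hp
    rw [← bilin_sub_left, Pi.mul_apply, Real.enorm_eq_ofReal_abs,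
      Real.enorm_of_nonneg (hp.nonneg _), Real.enorm_of_nonneg (hp.nonneg _),
      ENNReal.ofReal_rpow_of_nonneg (hp.nonneg _) (by norm_num),
      ENNReal.ofReal_rpow_of_nonneg (hp.nonneg _) (by norm_num),
      ← ENNReal.ofReal_mul (Real.rpow_nonneg (hp.nonneg _) _), ← Real.sqrt_eq_rpow,
      ← Real.sqrt_eq_rpow]
    exact ENNReal.ofReal_le_ofReal (hp.abs_le_sqrt _ _)
  have hbm : ∀ k, AEStronglyMeasurable (fun p => bilin (a p) (spaceGrad (F k) p) (G p)) μ :=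
    fun k => (ha.aemeasurable_bilin hac (hgm k) hGm).aestronglyMeasurable
  have hbζ : Integrable (fun p => bilin (a p) (spaceGrad ζ p) (G p)) μ :=
    hS.integrableOn_bilin ha (continuous_spaceGrad hζ.smooth).measurable.aemeasurable
      (ha.integrable_bilin_spaceGrad hζ.smooth hζ.compact).integrableOn
  have hwq : Integrable (fun p => |w p| ^ q) μ := hS.integrableOn_abs_rpow hq
  have hs : Integrable s μ := hS.integrable_timeDeriv
  obtain ⟨e1, i1, t1⟩ := tendsto_integral_bdd_mul c1 hm1 l1 (fun _ => hs.1) hs (hconst s)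
  obtain ⟨e2, i2, t2⟩ := tendsto_integral_bdd_mul c2 hm2 l2 hbm hS.integrable_form hform
  obtain ⟨e3, i3, t3⟩ := tendsto_integral_bdd_mul c3 hm3 l3 (fun _ => hbζ.1) hbζ (hconst _)
  obtain ⟨e4, i4, t4⟩ := tendsto_integral_bdd_mul c1 hm1 l1 (fun _ => hwq.1) hwq (hconst _)
  -- the weak inequality in the limit
  have hlim : 0 ≤ ((∫ p, h (w p) * ζ p * s p ∂μ)
      + ∫ p, h' (w p) * ζ p * bilin (a p) (G p) (G p) ∂μ)
      + (∫ p, h (w p) * bilin (a p) (spaceGrad ζ p) (G p) ∂μ)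
      - κ * ∫ p, h (w p) * ζ p * |w p| ^ q ∂μ := by
    refine ge_of_tendsto (((t1.add t2).add t3).sub (t4.const_mul κ)) ?_
    filter_upwards [e1, e2, e3, e4] with k e1 e2 e3 e4
    have htest : IsTest (fun p => h (F k p) * ζ p) :=
      ⟨(hh.comp (hF k)).mul hζ.smooth, hζ.compact.mul_left,
        fun p => mul_nonneg (h0 _) (hζ.nonneg p)⟩
    have h6 := hw.ineq _ htest
    rw [← setIntegral_eq_integral_of_forall_compl_eq_zero (s := B)] at h6
    · rw [← integral_add_add_sub_const_mul e1 e2 e3 e4]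
      refine h6.trans_eq (integral_congr_ae (ae_of_all _ fun p => ?_))
      have hcomp : spaceGrad (fun p => h (F k p) * ζ p) p
          = h (F k p) • spaceGrad ζ p + ζ p • h' (F k p) • spaceGrad (F k) p := by
        have hhF : DifferentiableAt ℝ (fun p => h (F k p)) p :=
          (hh' _).differentiableAt.comp p (hFd k p)
        rw [spaceGrad_mul hhF (hζd p),
          spaceGrad_comp (hh' _) (hFd k p)]
      simp only [hcomp, bilin_add_left, bilin_smul_left]
      ring
    · intro p hp
      have hp' : p ∉ tsupport (fun p => h (F k p) * ζ p) := fun hx =>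
        hp (hBζ (tsupport_mul_subset_right hx))
      rw [spaceGrad_eq_zero_of_notMem hp', image_eq_zero_of_notMem_tsupport hp']
      simp [bilin]
  -- integration by parts in time
  have hwi : Integrable w μ := hS.memLp.integrable (by simpa using ENNReal.ofReal_le_ofReal hq.le)
  have hHw : Integrable (fun p => H (w p)) μ := by
    refine ((integrable_const |H 0|).add (hwi.norm.const_mul M)).mono'
      (hHd.continuous.comp_aestronglyMeasurable hwm) (ae_of_all _ fun p => ?_)
    have h7 := hHlip (w p) 0
    have h8 := abs_sub_abs_le_abs_sub (H (w p)) (H 0)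
    rw [sub_zero] at h7
    change |H (w p)| ≤ |H 0| + M * |w p|
    linarith
  have hHlim : Tendsto (fun k => ∫⁻ p, ‖H (F k p) - H (w p)‖ₑ ∂μ) atTop (𝓝 0) := by
    have h4 := ENNReal.Tendsto.const_mul (a := ENNReal.ofReal M) h1 (Or.inr (by simp))
    rw [mul_zero] at h4
    refine tendsto_of_tendsto_of_tendsto_of_le_of_le tendsto_const_nhds h4
      (fun _ => zero_le) fun k => ?_
    simp only
    rw [← lintegral_const_mul' _ _ (by simp)]
    refine lintegral_mono fun p => ?_
    rw [Real.enorm_eq_ofReal_abs, Real.enorm_eq_ofReal_abs, ← ENNReal.ofReal_mul hM0]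
    exact ENNReal.ofReal_le_ofReal (hHlip _ _)
  obtain ⟨e5, i5, t5⟩ := tendsto_integral_bdd_mul c1 hm1 l1
    (fun k => (continuous_timeDeriv (hF k)).aestronglyMeasurable) hs h2
  obtain ⟨e6, i6, t6⟩ := tendsto_integral_bdd_mul (m := fun _ => timeDeriv ζ) (m' := timeDeriv ζ)
    (fun _ => hζt.aestronglyMeasurable) (fun _ => hMt)
    (ae_of_all _ fun p => tendsto_const_nhds)
    (fun k => (hHd.continuous.comp (hFc k)).aestronglyMeasurable) hHw hHlim
  have hparts : (∫ p, h (w p) * ζ p * s p ∂μ) + ∫ p, timeDeriv ζ p * H (w p) ∂μ = 0 := by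
    refine tendsto_nhds_unique (t5.add t6) (Tendsto.congr' ?_ tendsto_const_nhds)
    filter_upwards [e5, e6] with k e5 e6
    have hsm : ContDiff ℝ ∞ (fun p => H (F k p) * ζ p) := (hHs.comp (hF k)).mul hζ.smooth
    have hcs : HasCompactSupport (fun p => H (F k p) * ζ p) := hζ.compact.mul_left
    have h9 := integral_timeDeriv_eq_zero hsm hcs
    rw [← setIntegral_eq_integral_of_forall_compl_eq_zero (s := B)] at h9
    · rw [← integral_add e5 e6, ← h9]
      refine integral_congr_ae (ae_of_all _ fun p => ?_)
      have hHF : DifferentiableAt ℝ (fun p => H (F k p)) p :=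
        (hH _).differentiableAt.comp p (hFd k p)
      simp only [Function.comp_apply]
      rw [timeDeriv_mul hHF (hζd p), timeDeriv_comp (hH _) (hFd k p)]
      ring
    · intro p hp
      exact timeDeriv_eq_zero_of_notMem fun hx => hp (hBζ (tsupport_mul_subset_right hx))
  have hi : Integrable (fun p => -(H (w p) * timeDeriv ζ p)
      + h' (w p) * ζ p * bilin (a p) (G p) (G p)
      + h (w p) * bilin (a p) (spaceGrad ζ p) (G p) - κ * (h (w p) * ζ p * |w p| ^ q)) μ := by
    refine (((i6.neg.add i2).add i3).sub (i4.const_mul κ)).congr (ae_of_all _ fun p => ?_)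
    simp only [Pi.add_apply, Pi.sub_apply, Pi.neg_apply]
    ring
  have hzero : ∀ p ∉ B, -(H (w p) * timeDeriv ζ p)
      + h' (w p) * ζ p * bilin (a p) (G p) (G p)
      + h (w p) * bilin (a p) (spaceGrad ζ p) (G p) - κ * (h (w p) * ζ p * |w p| ^ q) = 0 := by
    intro p hp
    have hp' : p ∉ tsupport ζ := fun hx => hp (hBζ hx)
    rw [timeDeriv_eq_zero_of_notMem hp', spaceGrad_eq_zero_of_notMem hp',
      image_eq_zero_of_notMem_tsupport hp']
    simp [bilin]
  refine ⟨IntegrableOn.integrable_of_forall_notMem_eq_zero hi hzero, ?_⟩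
  rw [← setIntegral_eq_integral_of_forall_compl_eq_zero hzero]
  refine hlim.trans_eq ?_
  have i6' : Integrable (fun p => -(timeDeriv ζ p * H (w p))) μ := i6.neg
  rw [show (∫ p, h (w p) * ζ p * s p ∂μ) = ∫ p, -(timeDeriv ζ p * H (w p)) ∂μ by
    rw [integral_neg]; linarith, ← integral_add_add_sub_const_mul i6' i2 i3 i4]
  refine integral_congr_ae (ae_of_all _ fun p => ?_)
  ring

end WeakInequality

/-! ### Smooth multipliers that are negative powers on the half-line -/

/-- The translation `τ ↦ τ + ε` of the half-line `[0, ∞)` extends to a smooth function on `ℝ` with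
values in `[ε / 2, ∞)` and bounded derivative. -/
lemma exists_smooth_shift {ε : ℝ} (hε : 0 < ε) : ∃ (g : ℝ → ℝ) (M : ℝ), ContDiff ℝ ∞ g ∧
    (∀ x, ε / 2 ≤ g x) ∧ (∀ x, 0 ≤ x → g x = x + ε) ∧ (∀ x, 0 ≤ x → deriv g x = 1) ∧
    ∀ x, |deriv g x| ≤ M := by
  set g : ℝ → ℝ := fun x => ε + x * Real.smoothTransition (2 + 4 * x / ε) with hg
  have hgs : ContDiff ℝ ∞ g :=
    contDiff_const.add (contDiff_id.mul (Real.smoothTransition.contDiff.comp (by fun_prop)))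
  have hleft : ∀ x, x < -(ε / 2) → g x = ε := fun x hx => by
    have : 2 + 4 * x / ε ≤ 0 := by
      rw [← le_neg_iff_add_nonpos_left, div_le_iff₀ hε]; linarith
    simp [hg, Real.smoothTransition.zero_of_nonpos this]
  have hright : ∀ x, -(ε / 4) < x → g x = x + ε := fun x hx => by
    have : 1 ≤ 2 + 4 * x / ε := by
      rw [← sub_le_iff_le_add', le_div_iff₀ hε]; linarith
    simp [hg, Real.smoothTransition.one_of_one_le this, add_comm]
  have hd0 : ∀ x, x < -(ε / 2) → deriv g x = 0 := fun x hx => by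
    have : g =ᶠ[𝓝 x] fun _ => ε := by
      filter_upwards [Iio_mem_nhds hx] with y hy using hleft y hy
    rw [this.deriv_eq, deriv_const]
  have hd1 : ∀ x, -(ε / 4) < x → deriv g x = 1 := fun x hx => by
    have : g =ᶠ[𝓝 x] fun y => y + ε := by
      filter_upwards [Ioi_mem_nhds hx] with y hy using hright y hy
    rw [this.deriv_eq, deriv_add_const, deriv_id'']
  obtain ⟨M, hM⟩ := (isCompact_Icc (a := -ε) (b := 0)).exists_bound_of_continuousOn
    (hgs.continuous_deriv (by simp)).continuousOn
  refine ⟨g, max M 1, hgs, fun x => ?_, fun x hx => hright x (by linarith),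
    fun x hx => hd1 x (by linarith), fun x => ?_⟩
  · have h0 := Real.smoothTransition.nonneg (2 + 4 * x / ε)
    have h1 := Real.smoothTransition.le_one (2 + 4 * x / ε)
    rcases lt_or_ge x (-(ε / 2)) with hx | hx
    · rw [hleft x hx]; linarith
    · change ε / 2 ≤ ε + x * _
      rcases le_total 0 x with hx' | hx' <;> nlinarith
  · rcases lt_or_ge x (-ε) with hx | hx
    · rw [hd0 x (by linarith), abs_zero]; positivity
    · rcases le_total x 0 with hx' | hx'
      · exact (hM x ⟨hx, hx'⟩).trans (le_max_left _ _)
      · rw [hd1 x (by linarith), abs_one]; exact le_max_right _ _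

/-- The function `τ ↦ (τ + ε)^{-ν}` on `[0, ∞)` extends to a smooth, non-negative, bounded function
`h` on `ℝ` with bounded derivative; `H` is a primitive of `h`. -/
lemma exists_smooth_neg_rpow {ε ν : ℝ} (hε : 0 < ε) (hν : 0 < ν) (hν1 : ν < 1) :
    ∃ (H h h' : ℝ → ℝ) (M : ℝ), ContDiff ℝ ∞ h ∧ (∀ x, HasDerivAt H (h x) x) ∧
      (∀ x, HasDerivAt h (h' x) x) ∧ (∀ x, 0 ≤ h x) ∧ (∀ x, h x ≤ M) ∧ (∀ x, |h' x| ≤ M) ∧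
      ∀ x, 0 ≤ x → H x = (x + ε) ^ (1 - ν) / (1 - ν) ∧ h x = (x + ε) ^ (-ν) ∧
        h' x = -ν * (x + ε) ^ (-ν - 1) := by
  obtain ⟨g, M, hg, hg0, hg1, hgd, hM⟩ := exists_smooth_shift hε
  have hpos : ∀ x, 0 < g x := fun x => (half_pos hε).trans_le (hg0 x)
  have hhs : ContDiff ℝ ∞ fun x => g x ^ (-ν) := hg.rpow_const_of_ne fun x => (hpos x).ne'
  have hgD : ∀ x, HasDerivAt g (deriv g x) x := fun x =>
    (hg.differentiable (by simp) x).hasDerivAt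
  have hM0 : 0 ≤ M := (abs_nonneg _).trans (hM 0)
  refine ⟨fun x => ε ^ (1 - ν) / (1 - ν) + ∫ t in (0)..x, g t ^ (-ν), fun x => g x ^ (-ν),
    fun x => deriv g x * -ν * g x ^ (-ν - 1),
    max ((ε / 2) ^ (-ν)) (M * ν * (ε / 2) ^ (-ν - 1)), hhs, fun x => ?_, fun x => ?_, fun x => ?_,
    fun x => ?_, fun x => ?_, fun x hx => ⟨?_, ?_, ?_⟩⟩
  · exact (hhs.continuous.integral_hasStrictDerivAt 0 x).hasDerivAt.const_add _
  · exact (hgD x).rpow_const (Or.inl (hpos x).ne')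
  · exact Real.rpow_nonneg (hpos x).le _
  · exact (Real.rpow_le_rpow_of_nonpos (half_pos hε) (hg0 x) (by linarith)).trans
      (le_max_left _ _)
  · refine le_trans ?_ (le_max_right _ _)
    rw [abs_mul, abs_mul, abs_neg, abs_of_pos hν, abs_of_nonneg (Real.rpow_nonneg (hpos x).le _)]
    refine mul_le_mul (mul_le_mul_of_nonneg_right (hM x) hν.le)
      (Real.rpow_le_rpow_of_nonpos (half_pos hε) (hg0 x) (by linarith))
      (Real.rpow_nonneg (hpos x).le _) (by positivity)
  · have h1 : ∀ t ∈ Set.uIcc 0 x,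
        HasDerivAt (fun t => (t + ε) ^ (1 - ν) / (1 - ν)) (g t ^ (-ν)) t := by
      intro t ht
      rw [Set.uIcc_of_le hx] at ht
      rw [hg1 t ht.1]
      have h2 := (((hasDerivAt_id t).add_const ε).rpow_const (p := 1 - ν)
        (Or.inl (by simp only [id]; linarith [ht.1]))).div_const (1 - ν)
      convert! h2 using 1
      have : (1 - ν) ≠ 0 := by linarith
      rw [show 1 - ν - 1 = -ν by ring]
      simp only [id]
      field_simp
    have h3 := intervalIntegral.integral_eq_sub_of_hasDerivAt h1
      (hhs.continuous.intervalIntegrable 0 x)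
    simp only
    rw [h3, zero_add]
    ring
  · simp only [hg1 x hx]
  · simp only [hg1 x hx, hgd x hx, one_mul]

/-! ### The test function estimates -/

/-- The cutoff functions of the argument, with constants in terms of a small parameter `e`: `Z = 1`
on `K`, `Z = 0` off `Q`, the time derivative and the energy density of `Z` are at most
`C * e ^ (q - 1)`, and the volume of `Q` is at most `C * e ^ (-q)`. -/
structure IsCutoff {n : ℕ} (a : SpaceTime n → Matrix (Fin n) (Fin n) ℝ) (q C e : ℝ)
    (K Q : Set (SpaceTime n)) (Z : SpaceTime n → ℝ) : Prop where
  smooth : ContDiff ℝ ∞ Z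
  compact : HasCompactSupport Z
  nonneg : ∀ p, 0 ≤ Z p
  le_one : ∀ p, Z p ≤ 1
  eq_one : ∀ p ∈ K, Z p = 1
  eq_zero : ∀ p ∉ Q, Z p = 0
  measurableSet_left : MeasurableSet K
  measurableSet_right : MeasurableSet Q
  timeDeriv_eq_zero : ∀ p ∉ Q \ K, timeDeriv Z p = 0
  spaceGrad_eq_zero : ∀ p ∉ Q \ K, spaceGrad Z p = 0
  timeDeriv_le : ∀ p, |timeDeriv Z p| ≤ C * e ^ (q - 1)
  form_le : ∀ᵐ p, bilin (a p) (spaceGrad Z p) (spaceGrad Z p) ≤ C * e ^ (q - 1)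
  volume_le : volume Q ≤ ENNReal.ofReal (C * e ^ (-q))

section Estimates

variable {n : ℕ} {a : SpaceTime n → Matrix (Fin n) (Fin n) ℝ} {A : SpaceTime n → ℝ}
  {q κ ν C e : ℝ} {K Q : Set (SpaceTime n)} {Z w s : SpaceTime n → ℝ}
  {G : SpaceTime n → EuclideanSpace ℝ (Fin n)}

lemma IsCutoff.isTest_pow (hZ : IsCutoff a q C e K Q Z) {m : ℕ} (hm : m ≠ 0) :
    IsTest fun p => Z p ^ m :=
  ⟨hZ.smooth.pow m, hZ.compact.comp_left (zero_pow hm), fun p => pow_nonneg (hZ.nonneg p) m⟩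

lemma IsCutoff.timeDeriv_pow (hZ : IsCutoff a q C e K Q Z) (m : ℕ) (p : SpaceTime n) :
    timeDeriv (fun p => Z p ^ m) p = m * Z p ^ (m - 1) * timeDeriv Z p :=
  timeDeriv_comp (h := fun x => x ^ m) (hasDerivAt_pow m _) (hZ.smooth.differentiable (by simp) p)

lemma IsCutoff.spaceGrad_pow (hZ : IsCutoff a q C e K Q Z) (m : ℕ) (p : SpaceTime n) :
    spaceGrad (fun p => Z p ^ m) p = (m * Z p ^ (m - 1)) • spaceGrad Z p :=
  spaceGrad_comp (h := fun x => x ^ m) (hasDerivAt_pow m _) (hZ.smooth.differentiable (by simp) p)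

lemma IsCutoff.measure_lt_top (hZ : IsCutoff a q C e K Q Z) : volume Q < ⊤ :=
  hZ.volume_le.trans_lt ENNReal.ofReal_lt_top

lemma IsCutoff.integrable_indicator (hZ : IsCutoff a q C e K Q Z) (c : ℝ) :
    Integrable (Q.indicator fun _ => c) :=
  (integrable_indicator_iff hZ.measurableSet_right).2
    (integrableOn_const hZ.measure_lt_top.ne)

/-- A density of size `c e^q` has an integral of size `c` over `Q`. -/
lemma IsCutoff.integral_indicator_le (hZ : IsCutoff a q C e K Q Z) (hC : 0 < C) (he : 0 < e)
    {c r : ℝ} (hc : 0 ≤ c) :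
    ∫ p, Q.indicator (fun _ => c * e ^ (q - r)) p ≤ C * c * e ^ (-r) := by
  rw [integral_indicator hZ.measurableSet_right, setIntegral_const, smul_eq_mul]
  have h1 : volume.real Q ≤ C * e ^ (-q) :=
    ENNReal.toReal_le_of_le_ofReal (by positivity) hZ.volume_le
  refine (mul_le_mul_of_nonneg_right h1 (by positivity)).trans_eq ?_
  rw [show -r = -q + (q - r) by ring, Real.rpow_add he]
  ring

/-- The pointwise bound for the cross term, before the choice of the weight. -/
lemma abs_cross_term_le {m : ℕ} (hm : 2 ≤ m) {M : Matrix (Fin n) (Fin n) ℝ}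
    (hM : IsPosSemidefForm M) {W z l : ℝ} (hW : 0 < W) (hz : 0 ≤ z) (hl : 0 < l)
    (ξ η : EuclideanSpace ℝ (Fin n)) :
    m * z ^ (m - 1) * |bilin M ξ η| ≤
      l / 2 * W⁻¹ * z ^ m * bilin M η η + W * z ^ (m - 2) * (m ^ 2 * bilin M ξ ξ / (2 * l)) := by
  have h := hM.abs_le_weighted hl ((m : ℝ) • ξ) ((z * W⁻¹) • η)
  simp only [bilin_smul_left, bilin_smul_right] at h
  rw [abs_mul, abs_of_nonneg (by positivity : 0 ≤ z * W⁻¹), abs_mul, Nat.abs_cast] at h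
  have h2 := mul_le_mul_of_nonneg_left h (by positivity : 0 ≤ W * z ^ (m - 2))
  have e1 : z ^ (m - 1) = z ^ (m - 2) * z := by
    rw [← pow_succ]; congr 1; omega
  have e2 : z ^ m = z ^ (m - 2) * z * z := by
    rw [← e1, ← pow_succ]; congr 1; omega
  have hW' := mul_inv_cancel₀ hW.ne'
  rw [e1, e2]
  calc _ = (W * W⁻¹) * (m * (z ^ (m - 2) * z) * |bilin M ξ η|) := by rw [hW', one_mul]
    _ = W * z ^ (m - 2) * (z * W⁻¹ * (m * |bilin M ξ η|)) := by ring
    _ ≤ W * z ^ (m - 2) * (l / 2 * (z * W⁻¹ * (z * W⁻¹ * bilin M η η))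
        + m * (m * bilin M ξ ξ) / (2 * l)) := h2
    _ = (W * W⁻¹) * (l / 2 * W⁻¹ * (z ^ (m - 2) * z * z) * bilin M η η)
        + W * z ^ (m - 2) * (m ^ 2 * bilin M ξ ξ / (2 * l)) := by ring
    _ = _ := by rw [hW', one_mul]

lemma rpow_add_le_mul (hq : 1 ≤ q) {x y : ℝ} (hx : 0 ≤ x) (hy : 0 ≤ y) :
    (x + y) ^ q ≤ 2 ^ (q - 1) * (x ^ q + y ^ q) := by
  exact_mod_cast NNReal.rpow_add_le_mul_rpow_add_rpow ⟨x, hx⟩ ⟨y, hy⟩ hq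

lemma IsCutoff.integrable_mul_pow (hq : 1 < q) (hw : WeakInequality a q κ w s G)
    (hZ : IsCutoff a q C e K Q Z) {m : ℕ} (hm : m ≠ 0) :
    Integrable fun p => |w p| ^ q * Z p ^ m := by
  have ht := hZ.isTest_pow hm
  obtain ⟨ρ, hρ, hB⟩ := exists_tsupport_subset_ball ht.compact
  exact integrable_mul_of_bdd ht.smooth.continuous ht.compact hB
    ((hw.sobolevOn ρ hρ).integrableOn_abs_rpow hq)

lemma IsCutoff.integrable_weighted_energy (hw : WeakInequality a q κ w s G)
    (hZ : IsCutoff a q C e K Q Z) {m : ℕ} (hm : m ≠ 0) (hν : 0 < ν) {ε : ℝ} (hε : 0 < ε) :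
    Integrable fun p => (w p + ε) ^ (-ν - 1) * Z p ^ m * bilin (a p) (G p) (G p) := by
  have ht := hZ.isTest_pow hm
  obtain ⟨ρ, hρ, hB⟩ := exists_tsupport_subset_ball ht.compact
  have h1 := integrable_mul_of_bdd ht.smooth.continuous ht.compact hB
    (hw.sobolevOn ρ hρ).integrable_form
  have h2 : AEStronglyMeasurable (fun p => (w p + ε) ^ (-ν - 1)) volume :=
    ((hw.aemeasurable.add_const ε).pow_const _).aestronglyMeasurable
  refine (h1.bdd_mul (c := ε ^ (-ν - 1)) h2 ?_).congr (ae_of_all _ fun p => ?_)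
  · filter_upwards [hw.nonneg] with p hp
    rw [Real.norm_of_nonneg (by positivity)]
    exact Real.rpow_le_rpow_of_nonpos hε (by linarith) (by linarith)
  · simp only
    ring

/-- The weighted energy estimate: test with `(w + ε)^{-ν} Z^m` and absorb the cross term into the
energy and the remaining terms into the nonlinearity. -/
lemma exists_energy_estimate (hq : 1 < q) (ha : IsCoefficient a A) (hκ : 0 < κ) (hν : 0 < ν)
    (hν1 : ν < 1) {m : ℕ} (hm : 2 * q ≤ m * (q - 1)) (hC : 0 < C) (hw : WeakInequality a q κ w s G) :
    ∃ C₁ : ℝ, 0 < C₁ ∧ ∀ (e ε : ℝ) (K Q : Set (SpaceTime n)) (Z : SpaceTime n → ℝ), 0 < ε → ε ≤ e →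
      IsCutoff a q C e K Q Z →
      ∫ p, (w p + ε) ^ (-ν - 1) * Z p ^ m * bilin (a p) (G p) (G p) ≤ C₁ * e ^ (-ν) := by
  have hm2 : 2 ≤ m := by
    by_contra! hlt
    have h0 : (0 : ℝ) ≤ m := Nat.cast_nonneg m
    have h1 : (m : ℝ) ≤ 1 := by exact_mod_cast Nat.lt_succ_iff.1 hlt
    nlinarith
  have hν1' : 0 < 1 - ν := by linarith
  set C₂ : ℝ := m * C / (1 - ν) + m ^ 2 * C / (2 * ν) with hC₂
  have hC₂0 : 0 < C₂ := by positivity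
  have hη : 0 < κ * 2 ^ (1 - q) / C₂ := by positivity
  obtain ⟨C₃, hC₃, hY⟩ := exists_young_cutoff (p := 1 - ν) (q := q - ν) hν1' (by linarith) hη
    (s := m) (by nlinarith)
  refine ⟨2 / ν * (C * (C₂ * C₃ + κ)), by positivity, fun e ε K Q Z hε hεe hZ => ?_⟩
  have he : 0 < e := hε.trans_le hεe
  obtain ⟨H, h, h', M, hh, hH, hh', h0, hM, hM', heq⟩ := exists_smooth_neg_rpow hε hν hν1
  obtain ⟨hint, hpos⟩ := hw.test_comp hq ha hh hH hh' h0 hM hM' (hZ.isTest_pow (m := m) (by omega))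
  have hD := hZ.integrable_weighted_energy hw (m := m) (by omega) hν hε
  have hmain := hpos.trans (integral_mono_ae hint ((hD.const_mul (-(ν / 2))).add
    (hZ.integrable_indicator ((C₂ * C₃ + κ) * e ^ (q - ν)))) ?_)
  · rw [integral_add' (hD.const_mul _) (hZ.integrable_indicator _), integral_const_mul] at hmain
    have h1 := hZ.integral_indicator_le hC he (c := C₂ * C₃ + κ) (r := ν) (by positivity)
    rw [div_mul_eq_mul_div, div_mul_eq_mul_div, le_div_iff₀ hν]
    linarith
  filter_upwards [hw.nonneg, ha.isPosSemidefForm, hZ.form_le] with p hwp hp hform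
  obtain ⟨e1, e2, e3⟩ := heq (w p) hwp
  simp only [e1, e2, e3, hZ.timeDeriv_pow, hZ.spaceGrad_pow, bilin_smul_left, Pi.add_apply]
  by_cases hpQ : p ∈ Q
  swap
  · have hz := hZ.eq_zero p hpQ
    simp [hpQ, hz, zero_pow (show m ≠ 0 by omega), zero_pow (show m - 1 ≠ 0 by omega)]
  rw [Set.indicator_of_mem hpQ, abs_of_nonneg hwp]
  set W := w p + ε with hWdef
  have hW : 0 < W := by positivity
  set z := Z p with hz
  have hz0 : 0 ≤ z := hZ.nonneg p
  have hz1 : z ≤ 1 := hZ.le_one p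
  set b := bilin (a p) (G p) (G p) with hb
  have hWν : W ^ (1 - ν) = W * W ^ (-ν) := by
    rw [sub_eq_add_neg, Real.rpow_add hW, Real.rpow_one]
  have hWν' : W ^ (-ν - 1) = W ^ (-ν) * W⁻¹ := by
    rw [Real.rpow_sub hW, Real.rpow_one, div_eq_mul_inv]
  have hzpow : z ^ (m - 1) ≤ z ^ (m - 2) := pow_le_pow_of_le_one hz0 hz1 (by omega)
  -- the time derivative
  have t1 : -(W ^ (1 - ν) / (1 - ν) * (m * z ^ (m - 1) * timeDeriv Z p))
      ≤ m * C / (1 - ν) * (W ^ (1 - ν) * e ^ (q - 1) * z ^ (m - 2)) := by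
    have h1 : -timeDeriv Z p ≤ C * e ^ (q - 1) := (neg_le_abs _).trans (hZ.timeDeriv_le p)
    have h2 := mul_le_mul_of_nonneg_left h1
      (by positivity : 0 ≤ W ^ (1 - ν) / (1 - ν) * (m * z ^ (m - 1)))
    have h3 := mul_le_mul_of_nonneg_left hzpow
      (by positivity : 0 ≤ W ^ (1 - ν) / (1 - ν) * m * (C * e ^ (q - 1)))
    calc _ = W ^ (1 - ν) / (1 - ν) * (m * z ^ (m - 1)) * -timeDeriv Z p := by ring
      _ ≤ _ := h2
      _ = W ^ (1 - ν) / (1 - ν) * m * (C * e ^ (q - 1)) * z ^ (m - 1) := by ring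
      _ ≤ _ := h3
      _ = _ := by ring
  -- the cross term
  have t2 : W ^ (-ν) * (m * z ^ (m - 1) * bilin (a p) (spaceGrad Z p) (G p))
      ≤ ν / 2 * (W ^ (-ν - 1) * z ^ m * b)
        + m ^ 2 * C / (2 * ν) * (W ^ (1 - ν) * e ^ (q - 1) * z ^ (m - 2)) := by
    have h1 := mul_le_mul_of_nonneg_left
      ((mul_le_mul_of_nonneg_left (le_abs_self (bilin (a p) (spaceGrad Z p) (G p)))
        (by positivity : 0 ≤ m * z ^ (m - 1))).trans
        (abs_cross_term_le hm2 hp hW hz0 hν (spaceGrad Z p) (G p)))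
      (Real.rpow_nonneg hW.le (-ν))
    refine h1.trans ?_
    have h2 := mul_le_mul_of_nonneg_left hform
      (by positivity : 0 ≤ W ^ (-ν) * (W * z ^ (m - 2) * (m ^ 2 / (2 * ν))))
    rw [hWν, hWν']
    calc _ = ν / 2 * (W ^ (-ν) * W⁻¹ * z ^ m * b) + W ^ (-ν) * (W * z ^ (m - 2) * (m ^ 2 / (2 * ν)))
          * bilin (a p) (spaceGrad Z p) (spaceGrad Z p) := by ring
      _ ≤ ν / 2 * (W ^ (-ν) * W⁻¹ * z ^ m * b) + W ^ (-ν) * (W * z ^ (m - 2) * (m ^ 2 / (2 * ν)))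
          * (C * e ^ (q - 1)) := by gcongr
      _ = _ := by ring
  -- Young's inequality
  have t3 : C₂ * (W ^ (1 - ν) * e ^ (q - 1) * z ^ (m - 2))
      ≤ κ * 2 ^ (1 - q) * (W ^ (q - ν) * z ^ m) + C₂ * C₃ * e ^ (q - ν) := by
    have h1 := mul_le_mul_of_nonneg_left (hY W z e hW.le hz0 hz1 he.le) hC₂0.le
    rw [show q - ν - (1 - ν) = q - 1 by ring] at h1
    refine h1.trans_eq ?_
    field_simp
  -- the nonlinearity controls `W ^ (q - ν)` up to a small error
  have t4 : κ * 2 ^ (1 - q) * (W ^ (q - ν) * z ^ m) - κ * e ^ (q - ν)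
      ≤ κ * (W ^ (-ν) * z ^ m * w p ^ q) := by
    have h1 := mul_le_mul_of_nonneg_left (rpow_add_le_mul hq.le hwp hε.le)
      (by positivity : (0 : ℝ) ≤ 2 ^ (1 - q))
    rw [← mul_assoc, ← Real.rpow_add two_pos, show 1 - q + (q - 1) = 0 by ring, Real.rpow_zero,
      one_mul, ← hWdef] at h1
    have h2 : W ^ (-ν) * ε ^ q * z ^ m ≤ e ^ (q - ν) := by
      have h3 : W ^ (-ν) ≤ ε ^ (-ν) :=
        Real.rpow_le_rpow_of_nonpos hε (by linarith) (by linarith)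
      calc W ^ (-ν) * ε ^ q * z ^ m ≤ ε ^ (-ν) * ε ^ q * 1 := by
            gcongr; exact pow_le_one₀ hz0 hz1
        _ = ε ^ (q - ν) := by rw [mul_one, ← Real.rpow_add hε]; congr 1; ring
        _ ≤ e ^ (q - ν) := Real.rpow_le_rpow hε.le hεe (by linarith)
    have h4 : W ^ (q - ν) = W ^ (-ν) * W ^ q := by
      rw [← Real.rpow_add hW]; congr 1; ring
    have h5 := mul_le_mul_of_nonneg_left h1 (by positivity : 0 ≤ κ * (W ^ (-ν) * z ^ m))
    have h6 := mul_le_mul_of_nonneg_left h2 hκ.le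
    rw [h4]
    linarith
  have t5 : C₂ * (W ^ (1 - ν) * e ^ (q - 1) * z ^ (m - 2))
      = m * C / (1 - ν) * (W ^ (1 - ν) * e ^ (q - 1) * z ^ (m - 2))
        + m ^ 2 * C / (2 * ν) * (W ^ (1 - ν) * e ^ (q - 1) * z ^ (m - 2)) := by
    rw [hC₂, add_mul]
  linarith

/-- Testing with `Z^m` alone, the cross term being controlled by the weighted energy. The parameter
`l` is the weight in this step, and `Ψ` is any bound for the remaining terms, which live on the set
where `Z` is not locally constant. -/
lemma exists_cutoff_estimate (hq : 1 < q) (ha : IsCoefficient a A) (hκ : 0 < κ) (hν : 0 < ν)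
    (hν1 : ν < 1) {m : ℕ} (hm : 2 * q ≤ m * (q - 1)) (hC : 0 < C) (hw : WeakInequality a q κ w s G) :
    ∃ C₁ : ℝ, 0 < C₁ ∧ ∀ (e ε : ℝ) (K Q : Set (SpaceTime n)) (Z : SpaceTime n → ℝ), 0 < ε → ε ≤ e →
      IsCutoff a q C e K Q Z → ∀ (l : ℝ) (Ψ : SpaceTime n → ℝ), 0 < l → Integrable Ψ →
      (∀ᵐ p, (Q \ K).indicator (fun p => m * C * ((w p + ε) * e ^ (q - 1) * Z p ^ (m - 2))
        + m ^ 2 * C / (2 * l) * ((w p + ε) ^ (1 + ν) * e ^ (q - (1 + ν)) * Z p ^ (m - 2))) p ≤ Ψ p) →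
      κ * ∫ p, |w p| ^ q * Z p ^ m ≤ l * C₁ + ∫ p, Ψ p := by
  have hm2 : 2 ≤ m := by
    by_contra! hlt
    have h0 : (0 : ℝ) ≤ m := Nat.cast_nonneg m
    have h1 : (m : ℝ) ≤ 1 := by exact_mod_cast Nat.lt_succ_iff.1 hlt
    nlinarith
  obtain ⟨C₁, hC₁, hE⟩ := exists_energy_estimate hq ha hκ hν hν1 hm hC hw
  refine ⟨C₁ / 2, by positivity, fun e ε K Q Z hε hεe hZ l Ψ hl hΨ hle => ?_⟩
  have he : 0 < e := hε.trans_le hεe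
  obtain ⟨hint, hpos⟩ := hw.test_comp (H := id) (h := fun _ => 1) (h' := fun _ => 0) (M := 1) hq ha
    contDiff_const (fun x => hasDerivAt_id x) (fun x => hasDerivAt_const x 1)
    (fun _ => zero_le_one) (fun _ => le_rfl) (fun _ => by simp) (hZ.isTest_pow (m := m) (by omega))
  have hD := (hZ.integrable_weighted_energy hw (m := m) (by omega) hν hε).const_mul (l / 2 * e ^ ν)
  have hN := (hZ.integrable_mul_pow hq hw (m := m) (by omega)).const_mul κ
  have hmain := hpos.trans (integral_mono_ae hint ((hD.add hΨ).sub hN) ?_)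
  · rw [integral_sub' (hD.add hΨ) hN, integral_add' hD hΨ, integral_const_mul,
      integral_const_mul] at hmain
    have h1 := mul_le_mul_of_nonneg_left (hE e ε K Q Z hε hεe hZ)
      (by positivity : 0 ≤ l / 2 * e ^ ν)
    have h2 : l / 2 * e ^ ν * (C₁ * e ^ (-ν)) = l * (C₁ / 2) := by
      have : e ^ ν * e ^ (-ν) = 1 := by rw [← Real.rpow_add he]; simp
      linear_combination l / 2 * C₁ * this
    linarith
  filter_upwards [hw.nonneg, ha.isPosSemidefForm, hZ.form_le, hle] with p hwp hp hform hlep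
  simp only [id, hZ.timeDeriv_pow, hZ.spaceGrad_pow, bilin_smul_left, Pi.add_apply, Pi.sub_apply,
    one_mul, zero_mul, add_zero]
  set W := w p + ε with hWdef
  have hW : 0 < W := by positivity
  set z := Z p with hz
  have hz0 : 0 ≤ z := hZ.nonneg p
  have hz1 : z ≤ 1 := hZ.le_one p
  set b := bilin (a p) (G p) (G p) with hb
  have hb0 : 0 ≤ b := hp.nonneg _
  have hDp : 0 ≤ l / 2 * e ^ ν * (W ^ (-ν - 1) * z ^ m * b) := by positivity
  by_cases hpE : p ∈ Q \ K
  swap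
  · rw [Set.indicator_of_notMem hpE] at hlep
    have h0 : bilin (a p) 0 (G p) = 0 := by simp [bilin]
    rw [hZ.timeDeriv_eq_zero p hpE, hZ.spaceGrad_eq_zero p hpE, h0]
    simp only [mul_zero, neg_zero, add_zero]
    linarith
  rw [Set.indicator_of_mem hpE] at hlep
  have hzpow : z ^ (m - 1) ≤ z ^ (m - 2) := pow_le_pow_of_le_one hz0 hz1 (by omega)
  have t1 : -(w p * (m * z ^ (m - 1) * timeDeriv Z p))
      ≤ m * C * (W * e ^ (q - 1) * z ^ (m - 2)) := by
    have h1 : -timeDeriv Z p ≤ C * e ^ (q - 1) := (neg_le_abs _).trans (hZ.timeDeriv_le p)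
    have h3 : w p ≤ W := by linarith
    calc _ = w p * (m * z ^ (m - 1)) * -timeDeriv Z p := by ring
      _ ≤ w p * (m * z ^ (m - 1)) * (C * e ^ (q - 1)) := by gcongr
      _ ≤ W * (m * z ^ (m - 2)) * (C * e ^ (q - 1)) := by gcongr
      _ = _ := by ring
  -- the weight is chosen such that the energy appears with the power `-ν - 1` of `W`
  have t2 : m * z ^ (m - 1) * bilin (a p) (spaceGrad Z p) (G p)
      ≤ l / 2 * e ^ ν * (W ^ (-ν - 1) * z ^ m * b)
        + m ^ 2 * C / (2 * l) * (W ^ (1 + ν) * e ^ (q - (1 + ν)) * z ^ (m - 2)) := by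
    have h1 := abs_cross_term_le hm2 hp hW hz0 (by positivity : 0 < l * e ^ ν * W ^ (-ν))
      (spaceGrad Z p) (G p)
    have h2 : m * z ^ (m - 1) * bilin (a p) (spaceGrad Z p) (G p)
        ≤ m * z ^ (m - 1) * |bilin (a p) (spaceGrad Z p) (G p)| := by
      gcongr; exact le_abs_self _
    refine (h2.trans h1).trans (add_le_add ?_ ?_)
    · rw [Real.rpow_sub hW, Real.rpow_one]
      apply le_of_eq
      rw [div_eq_mul_inv (W ^ (-ν)) W]
      ring
    · have h3 : W / W ^ (-ν) = W ^ (1 + ν) := by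
        rw [show 1 + ν = 1 - -ν by ring, Real.rpow_sub hW, Real.rpow_one]
      have h4 : e ^ (q - 1) / e ^ ν = e ^ (q - (1 + ν)) := by
        rw [← Real.rpow_sub he]; congr 1; ring
      calc _ ≤ W * z ^ (m - 2) * (m ^ 2 * (C * e ^ (q - 1)) / (2 * (l * e ^ ν * W ^ (-ν)))) := by
            gcongr
        _ = m ^ 2 * C / (2 * l) * (W / W ^ (-ν) * (e ^ (q - 1) / e ^ ν) * z ^ (m - 2)) := by
            field_simp
        _ = _ := by rw [h3, h4]
  linarith

/-- The integrals of `w ^ q` are bounded uniformly in the cutoff: all error terms are absorbed into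
the nonlinearity. -/
lemma exists_uniform_bound (hq : 1 < q) (ha : IsCoefficient a A) (hκ : 0 < κ) (hν : 0 < ν)
    (hν1 : ν < 1) (hνq : ν < q - 1) {m : ℕ} (hm : 2 * q ≤ m * (q - (1 + ν))) (hC : 0 < C)
    (hw : WeakInequality a q κ w s G) :
    ∃ C₂ : ℝ, ∀ (e : ℝ) (K Q : Set (SpaceTime n)) (Z : SpaceTime n → ℝ), 0 < e →
      IsCutoff a q C e K Q Z → ∫ p, |w p| ^ q * Z p ^ m ≤ C₂ := by
  have hm0 : (0 : ℝ) ≤ m := Nat.cast_nonneg m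
  have hm1 : 2 * q ≤ m * (q - 1) := by nlinarith
  have hmpos : (0 : ℝ) < m := by
    rcases hm0.eq_or_lt with h | h
    · rw [← h] at hm; linarith
    · exact h
  obtain ⟨C₁, hC₁, hest⟩ := exists_cutoff_estimate hq ha hκ hν hν1 hm1 hC hw
  have hη : 0 < κ * 2 ^ (-q) / 2 := by positivity
  obtain ⟨C₃, hC₃, hY₁⟩ := exists_young_cutoff one_pos hq (div_pos hη (by positivity :
    0 < m * C)) hm1
  obtain ⟨C₄, hC₄, hY₂⟩ := exists_young_cutoff (by linarith : 0 < 1 + ν) (by linarith : 1 + ν < q)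
    (div_pos hη (by positivity : 0 < m ^ 2 * C / (2 * 1))) hm
  set C₅ : ℝ := κ / 2 + m * C * C₃ + m ^ 2 * C / (2 * 1) * C₄ with hC₅
  have hC₅0 : 0 < C₅ := by positivity
  refine ⟨2 / κ * (C₁ + C * C₅), fun e K Q Z he hZ => ?_⟩
  have hN := hZ.integrable_mul_pow hq hw (m := m) (by rintro rfl; simp at hmpos)
  have h := hest e e K Q Z he le_rfl hZ 1 _ one_pos
    ((hN.const_mul (κ / 2)).add (hZ.integrable_indicator (C₅ * e ^ (q - 0)))) ?_
  · rw [integral_add' (hN.const_mul _) (hZ.integrable_indicator _), integral_const_mul] at h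
    have h1 := hZ.integral_indicator_le hC he (c := C₅) (r := 0) hC₅0.le
    rw [neg_zero, Real.rpow_zero, mul_one] at h1
    rw [div_mul_eq_mul_div, le_div_iff₀ hκ]
    linarith
  filter_upwards [hw.nonneg] with p hwp
  have hz0 := hZ.nonneg p
  have hz1 := hZ.le_one p
  have hfirst : 0 ≤ κ / 2 * (|w p| ^ q * Z p ^ m) := by positivity
  rw [Pi.add_apply]
  by_cases hpE : p ∈ Q \ K
  swap
  · rw [Set.indicator_of_notMem hpE]
    exact add_nonneg hfirst (Set.indicator_nonneg (fun _ _ => by positivity) p)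
  rw [Set.indicator_of_mem hpE, Set.indicator_of_mem hpE.1, sub_zero, abs_of_nonneg hwp]
  have hW : 0 ≤ w p + e := by positivity
  have h1 := mul_le_mul_of_nonneg_left (hY₁ _ _ _ hW hz0 hz1 he.le) (by positivity : 0 ≤ m * C)
  have h2 := mul_le_mul_of_nonneg_left (hY₂ _ _ _ hW hz0 hz1 he.le)
    (by positivity : 0 ≤ m ^ 2 * C / (2 * 1))
  rw [Real.rpow_one, mul_add, ← mul_assoc (m * C) (_ / _), mul_div_cancel₀ _ (by positivity)] at h1
  rw [mul_add, ← mul_assoc (m ^ 2 * C / (2 * 1)) (_ / _), mul_div_cancel₀ _ (by positivity)] at h2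
  have h3 : κ * 2 ^ (-q) * ((w p + e) ^ q * Z p ^ m)
      ≤ κ / 2 * (w p ^ q * Z p ^ m) + κ / 2 * e ^ q := by
    have h4 : (2 : ℝ) ^ (-q) * 2 ^ (q - 1) = 1 / 2 := by
      rw [← Real.rpow_add two_pos, show -q + (q - 1) = -1 by ring, Real.rpow_neg_one, one_div]
    calc _ ≤ κ * 2 ^ (-q) * (2 ^ (q - 1) * (w p ^ q + e ^ q) * Z p ^ m) := by
          gcongr; exact rpow_add_le_mul hq.le hwp he.le
      _ = κ * (2 ^ (-q) * 2 ^ (q - 1)) * (w p ^ q * Z p ^ m + e ^ q * Z p ^ m) := by ring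
      _ ≤ κ * (2 ^ (-q) * 2 ^ (q - 1)) * (w p ^ q * Z p ^ m + e ^ q * 1) := by
          gcongr; exact pow_le_one₀ hz0 hz1
      _ = _ := by rw [h4]; ring
  rw [hC₅]
  linarith

/-- Once `w ^ q` is integrable, the integral over the region of the cutoff is controlled by the tail
of the integral, up to an arbitrarily small error. -/
lemma exists_tail_bound (hq : 1 < q) (ha : IsCoefficient a A) (hκ : 0 < κ) (hν : 0 < ν)
    (hν1 : ν < 1) (hνq : ν < q - 1) {m : ℕ} (hm : 2 * q ≤ m * (q - (1 + ν))) (hC : 0 < C)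
    (hw : WeakInequality a q κ w s G) (hwq : Integrable fun p => |w p| ^ q) {δ : ℝ} (hδ : 0 < δ) :
    ∃ C₂ : ℝ, ∀ (e : ℝ) (K Q : Set (SpaceTime n)) (Z : SpaceTime n → ℝ), 0 < e →
      IsCutoff a q C e K Q Z →
      κ * ∫ p, |w p| ^ q * Z p ^ m ≤ δ + C₂ * ∫ p in Kᶜ, |w p| ^ q := by
  have hm0 : (0 : ℝ) ≤ m := Nat.cast_nonneg m
  have hm1 : 2 * q ≤ m * (q - 1) := by nlinarith
  have hmpos : (0 : ℝ) < m := by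
    rcases hm0.eq_or_lt with h | h
    · rw [← h] at hm; linarith
    · exact h
  obtain ⟨C₁, hC₁, hest⟩ := exists_cutoff_estimate hq ha hκ hν hν1 hm1 hC hw
  set l : ℝ := δ / (2 * C₁) with hl
  have hl0 : 0 < l := by positivity
  set η : ℝ := δ / (6 * C) with hη
  have hη0 : 0 < η := by positivity
  obtain ⟨C₃, hC₃, hY₁⟩ := exists_young (by linarith : 0 < q - 1) (by linarith : q - 1 < q)
    (div_pos hη0 (by positivity : 0 < m * C))
  obtain ⟨C₄, hC₄, hY₂⟩ := exists_young (by linarith : 0 < q - (1 + ν))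
    (by linarith : q - (1 + ν) < q) (div_pos hη0 (by positivity : 0 < m ^ 2 * C / (2 * l)))
  set C₅ : ℝ := (m * C * C₃ + m ^ 2 * C / (2 * l) * C₄) * 2 ^ (q - 1) with hC₅
  have hC₅0 : 0 < C₅ := by positivity
  -- the translation of `w` is by `t * e`, so small that it does not contribute
  set t : ℝ := min 1 ((η / C₅) ^ (1 / q)) with ht
  have ht0 : 0 < t := lt_min one_pos (by positivity)
  have htq : C₅ * t ^ q ≤ η := by
    rw [← le_div_iff₀' hC₅0]
    calc t ^ q ≤ ((η / C₅) ^ (1 / q)) ^ q :=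
          Real.rpow_le_rpow ht0.le (min_le_right _ _) (by linarith)
      _ = η / C₅ := by
          rw [← Real.rpow_mul (by positivity), one_div_mul_cancel (by linarith), Real.rpow_one]
  refine ⟨C₅, fun e K Q Z he hZ => ?_⟩
  have hKc : MeasurableSet Kᶜ := hZ.measurableSet_left.compl
  have hN : Integrable (Kᶜ.indicator fun p => C₅ * |w p| ^ q) :=
    (hwq.const_mul C₅).indicator hKc
  have hte : 0 < t * e := by positivity
  have h := hest e (t * e) K Q Z hte
    (by nlinarith [min_le_left 1 ((η / C₅) ^ (1 / q))]) hZ l _ hl0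
    (hN.add (hZ.integrable_indicator (3 * η * e ^ (q - 0)))) ?_
  · rw [integral_add' hN (hZ.integrable_indicator _), integral_indicator hKc,
      integral_const_mul] at h
    have h1 := hZ.integral_indicator_le hC he (c := 3 * η) (r := 0) (by positivity)
    rw [neg_zero, Real.rpow_zero, mul_one] at h1
    have h2 : l * C₁ + C * (3 * η) = δ := by
      rw [hl, hη]; field_simp; norm_num
    linarith
  filter_upwards [hw.nonneg] with p hwp
  have hz0 := hZ.nonneg p
  have hz1 := hZ.le_one p
  rw [Pi.add_apply]
  by_cases hpE : p ∈ Q \ K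
  swap
  · rw [Set.indicator_of_notMem hpE]
    exact add_nonneg (Set.indicator_nonneg (fun _ _ => by positivity) p)
      (Set.indicator_nonneg (fun _ _ => by positivity) p)
  rw [Set.indicator_of_mem hpE, Set.indicator_of_mem hpE.1, Set.indicator_of_mem (s := Kᶜ) hpE.2,
    sub_zero, abs_of_nonneg hwp]
  have hW : 0 ≤ w p + t * e := by positivity
  have hzm : Z p ^ (m - 2) ≤ 1 := pow_le_one₀ hz0 hz1
  have h1 := mul_le_mul_of_nonneg_left (hY₁ e _ he.le hW) (by positivity : 0 ≤ m * C)
  have h2 := mul_le_mul_of_nonneg_left (hY₂ e _ he.le hW)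
    (by positivity : 0 ≤ m ^ 2 * C / (2 * l))
  rw [sub_sub_cancel, Real.rpow_one, mul_add _ (_ / _ * _), ← mul_assoc (m * C) (_ / _),
    mul_div_cancel₀ _ (by positivity)] at h1
  rw [sub_sub_cancel, mul_add _ (_ / _ * _), ← mul_assoc (m ^ 2 * C / (2 * l)) (_ / _),
    mul_div_cancel₀ _ (by positivity)] at h2
  have h3 : m * C * ((w p + t * e) * e ^ (q - 1) * Z p ^ (m - 2))
      ≤ m * C * (e ^ (q - 1) * (w p + t * e)) := by
    rw [mul_comm (e ^ (q - 1))]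
    exact mul_le_mul_of_nonneg_left (mul_le_of_le_one_right (by positivity) hzm) (by positivity)
  have h4 : m ^ 2 * C / (2 * l) * ((w p + t * e) ^ (1 + ν) * e ^ (q - (1 + ν)) * Z p ^ (m - 2))
      ≤ m ^ 2 * C / (2 * l) * (e ^ (q - (1 + ν)) * (w p + t * e) ^ (1 + ν)) := by
    rw [mul_comm (e ^ (q - (1 + ν)))]
    exact mul_le_mul_of_nonneg_left (mul_le_of_le_one_right (by positivity) hzm) (by positivity)
  have h5 : (m * C * C₃ + m ^ 2 * C / (2 * l) * C₄) * (w p + t * e) ^ q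
      ≤ C₅ * w p ^ q + η * e ^ q := by
    calc _ ≤ (m * C * C₃ + m ^ 2 * C / (2 * l) * C₄) *
          (2 ^ (q - 1) * (w p ^ q + (t * e) ^ q)) := by
          gcongr; exact rpow_add_le_mul hq.le hwp hte.le
      _ = C₅ * w p ^ q + C₅ * t ^ q * e ^ q := by
          rw [hC₅, Real.mul_rpow ht0.le he.le]; ring
      _ ≤ _ := by gcongr
  linarith

/-- The Liouville theorem for `w_t ≥ 𝓛w + κ w^q`, under the assumption that there are cutoff
functions, with a common constant, whose plateaus exhaust the space-time. -/
lemma WeakInequality.ae_eq_zero (hq : 1 < q) (ha : IsCoefficient a A) (hκ : 0 < κ) (hC : 0 < C)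
    (hw : WeakInequality a q κ w s G) {K : ℕ → Set (SpaceTime n)} (hK : ∀ p, ∀ᶠ k in atTop, p ∈ K k)
    (hcut : ∀ k, ∃ (e : ℝ) (Q : Set (SpaceTime n)) (Z : SpaceTime n → ℝ), 0 < e ∧
      IsCutoff a q C e (K k) Q Z) : ∀ᵐ p, w p = 0 := by
  obtain ⟨ν, hν, hν1, hνq⟩ : ∃ ν : ℝ, 0 < ν ∧ ν < 1 ∧ ν < q - 1 := by
    have : 0 < min 1 (q - 1) := lt_min one_pos (by linarith)
    obtain ⟨ν, h1, h2⟩ := exists_between this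
    exact ⟨ν, h1, h2.trans_le (min_le_left _ _), h2.trans_le (min_le_right _ _)⟩
  have hr : 0 < q - (1 + ν) := by linarith
  obtain ⟨m, hm⟩ := exists_nat_ge (2 * q / (q - (1 + ν)))
  rw [div_le_iff₀ hr] at hm
  have hm0 : m ≠ 0 := by
    rintro rfl
    rw [Nat.cast_zero, zero_mul] at hm
    linarith
  choose e Q Z he hZ using hcut
  have hN := fun k => (hZ k).integrable_mul_pow hq hw (m := m) hm0
  have heq : ∀ k, ∀ p ∈ K k, |w p| ^ q * Z k p ^ m = |w p| ^ q := fun k p hp => by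
    rw [(hZ k).eq_one p hp, one_pow, mul_one]
  have hKm : ∀ k, MeasurableSet (K k) := fun k => (hZ k).measurableSet_left
  have hcover : AECover volume atTop K := ⟨ae_of_all _ hK, hKm⟩
  have hle : ∀ k, ∫ p in K k, |w p| ^ q ≤ ∫ p, |w p| ^ q * Z k p ^ m := fun k => by
    rw [← setIntegral_congr_fun (hKm k) (heq k)]
    refine setIntegral_le_integral (hN k) (ae_of_all _ fun p => ?_)
    exact mul_nonneg (by positivity) (pow_nonneg ((hZ k).nonneg p) m)
  have hwq : Integrable fun p => |w p| ^ q := by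
    obtain ⟨C₂, hC₂⟩ := exists_uniform_bound hq ha hκ hν hν1 hνq hm hC hw
    refine hcover.integrable_of_integral_norm_bounded C₂
      (fun k => ((hN k).integrableOn.congr_fun (heq k) (hKm k))) (Eventually.of_forall fun k => ?_)
    have : ∀ p, ‖|w p| ^ q‖ = |w p| ^ q := fun p => Real.norm_of_nonneg (by positivity)
    simp only [this]
    exact (hle k).trans (hC₂ _ _ _ _ (he k) (hZ k))
  have hlim := hcover.integral_tendsto_of_countably_generated hwq
  have hlim' : Tendsto (fun k => ∫ p in (K k)ᶜ, |w p| ^ q) atTop (𝓝 0) := by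
    have h1 := hlim.const_sub (∫ p, |w p| ^ q)
    rw [sub_self] at h1
    refine h1.congr fun k => ?_
    rw [← integral_add_compl (hKm k) hwq]
    ring
  have hzero : κ * ∫ p, |w p| ^ q ≤ 0 := by
    refine le_of_forall_pos_le_add fun δ hδ => ?_
    obtain ⟨C₂, hC₂⟩ := exists_tail_bound hq ha hκ hν hν1 hνq hm hC hw hwq hδ
    have h1 := (hlim'.const_mul C₂).const_add δ
    rw [mul_zero] at h1
    rw [zero_add, ← add_zero δ]
    exact le_of_tendsto_of_tendsto (hlim.const_mul κ) h1 (Eventually.of_forall fun k =>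
      (mul_le_mul_of_nonneg_left (hle k) hκ.le).trans (hC₂ _ _ _ _ (he k) (hZ k)))
  have hnn : ∀ p, 0 ≤ |w p| ^ q := fun p => by positivity
  have h0 : ∫ p, |w p| ^ q = 0 :=
    le_antisymm (by nlinarith) (integral_nonneg hnn)
  rw [integral_eq_zero_iff_of_nonneg hnn hwq] at h0
  filter_upwards [h0] with p hp
  simpa using ((Real.rpow_eq_zero (abs_nonneg _) (by linarith)).1 hp)

end Estimates

/-! ### Parabolic cutoff functions -/

section Cutoff

variable {n : ℕ}

lemma exists_time_bump : ∃ (θ : ℝ → ℝ) (M : ℝ), ContDiff ℝ ∞ θ ∧ (∀ t, 0 ≤ θ t) ∧ (∀ t, θ t ≤ 1) ∧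
    (∀ t, |t| ≤ 1 → θ t = 1) ∧ (∀ t, 2 ≤ |t| → θ t = 0) ∧ 0 ≤ M ∧ ∀ t, |deriv θ t| ≤ M := by
  let θ : ContDiffBump (0 : ℝ) := ⟨1, 2, one_pos, one_lt_two⟩
  have hs : ContDiff ℝ ∞ θ := θ.contDiff
  obtain ⟨M, hM⟩ := θ.hasCompactSupport.deriv.exists_bound_of_continuous
    (hs.continuous_deriv (by simp))
  refine ⟨θ, M, hs, fun t => θ.nonneg, fun t => θ.le_one, fun t ht => ?_, fun t ht => ?_,
    (norm_nonneg _).trans (hM 0), hM⟩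
  · exact θ.one_of_mem_closedBall (by simpa using ht)
  · exact θ.zero_of_le_dist (by simpa using ht)

/-- A radial cutoff whose gradient is supported strictly inside the annulus `1/2 < |x| < 1`. -/
lemma exists_space_bump : ∃ (χ : EuclideanSpace ℝ (Fin n) → ℝ) (M : ℝ), ContDiff ℝ ∞ χ ∧
    (∀ x, 0 ≤ χ x) ∧ (∀ x, χ x ≤ 1) ∧ (∀ x, ‖x‖ ≤ 1 / 2 → χ x = 1) ∧
    (∀ x, 1 ≤ ‖x‖ → χ x = 0) ∧
    (∀ x, ‖(WithLp.toLp 2 fun i => fderiv ℝ χ x (EuclideanSpace.single i 1) :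
      EuclideanSpace ℝ (Fin n))‖ ≤ M) ∧
    ∀ x, ¬ (1 / 2 < ‖x‖ ∧ ‖x‖ < 1) → fderiv ℝ χ x = 0 := by
  let χ : ContDiffBump (0 : EuclideanSpace ℝ (Fin n)) := ⟨5 / 8, 7 / 8, by norm_num, by norm_num⟩
  have hs : ContDiff ℝ ∞ χ := χ.contDiff
  have hcont : Continuous fun x => (WithLp.toLp 2 fun i => fderiv ℝ χ x
      (EuclideanSpace.single i 1) : EuclideanSpace ℝ (Fin n)) :=
    (PiLp.continuous_toLp 2 _).comp <| continuous_pi fun _ =>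
      (hs.continuous_fderiv (by simp)).clm_apply continuous_const
  have hd : ∀ x, x ∉ tsupport χ → fderiv ℝ χ x = 0 := fun x hx =>
    image_eq_zero_of_notMem_tsupport fun h => hx (tsupport_fderiv_subset ℝ h)
  obtain ⟨M, hM⟩ := (χ.hasCompactSupport.mono' (f := χ) (f' := fun x => (WithLp.toLp 2 fun i =>
    fderiv ℝ χ x (EuclideanSpace.single i 1) : EuclideanSpace ℝ (Fin n))) (fun x hx => by
      by_contra h
      refine hx ?_
      ext i
      simp [hd x h])).exists_bound_of_continuous hcont
  refine ⟨χ, M, hs, fun x => χ.nonneg, fun x => χ.le_one, fun x hx => ?_, fun x hx => ?_, hM,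
    fun x hx => ?_⟩
  · refine χ.one_of_mem_closedBall ?_
    rw [mem_closedBall_zero_iff]
    exact hx.trans (by change (1 : ℝ) / 2 ≤ 5 / 8; norm_num)
  · refine χ.zero_of_le_dist ?_
    rw [dist_zero_right]
    exact le_trans (by change (7 : ℝ) / 8 ≤ 1; norm_num) hx
  · rcases lt_or_ge ‖x‖ (5 / 8) with h | h
    · have : (χ : EuclideanSpace ℝ (Fin n) → ℝ) =ᶠ[𝓝 x] fun _ => 1 := by
        filter_upwards [Metric.isOpen_ball.mem_nhds (mem_ball_zero_iff.2 h)] with y hy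
        exact χ.one_of_mem_closedBall (Metric.ball_subset_closedBall hy)
      rw [this.fderiv_eq]
      simp
    · refine hd x ?_
      rw [χ.tsupport_eq, mem_closedBall_zero_iff]
      intro h'
      change ‖x‖ ≤ 7 / 8 at h'
      exact hx ⟨by linarith, by linarith⟩

/-- The parabolic cutoffs at scale `R`, with `|t| ≲ R ^ α` and `|x| ≲ R`; the parameter is
`e = R ^ (-α / (q - 1))`. The condition `q ≤ 1 + α / n` enters through the volume bound
`R ^ (α + n) ≤ e ^ (-q)`, and the growth condition on `A` through the energy density. -/
lemma exists_isCutoff (hn : 1 ≤ n) {α q : ℝ} (hq : 1 < q) (hqα : q ≤ 1 + α / n)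
    {a : SpaceTime n → Matrix (Fin n) (Fin n) ℝ} {A : SpaceTime n → ℝ} (ha : IsCoefficient a A)
    {c : ℝ} (hc : 0 < c)
    (hA : ∀ R : ℝ, 1 < R → annulusSup A R ≤ ENNReal.ofReal (c * R ^ (2 - α))) :
    ∃ C : ℝ, 0 < C ∧ ∀ R : ℝ, 1 < R → ∃ (e : ℝ) (Q : Set (SpaceTime n)) (Z : SpaceTime n → ℝ),
      0 < e ∧ IsCutoff a q C e {p | |p.1| < R ^ α ∧ ‖p.2‖ < R / 2} Q Z := by
  obtain ⟨θ, M, hθ, hθ0, hθ1, hθone, hθzero, hM0, hM⟩ := exists_time_bump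
  obtain ⟨χ, N, hχ, hχ0, hχ1, hχone, hχzero, hN, hχann⟩ := exists_space_bump (n := n)
  set V : ℝ := volume.real (Metric.ball (0 : EuclideanSpace ℝ (Fin n)) 1) with hV
  have hV0 : 0 ≤ V := measureReal_nonneg
  refine ⟨M + c * N ^ 2 + 4 * V + 1, by positivity, fun R hR => ?_⟩
  have hR0 : 0 < R := by linarith
  have hq1 : 0 < q - 1 := by linarith
  set T : ℝ := R ^ α with hT
  have hT0 : 0 < T := Real.rpow_pos_of_pos hR0 _
  set e : ℝ := R ^ (-(α / (q - 1))) with he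
  have he0 : 0 < e := Real.rpow_pos_of_pos hR0 _
  have heq : e ^ (q - 1) = T⁻¹ := by
    rw [he, ← Real.rpow_mul hR0.le, neg_mul, div_mul_cancel₀ _ hq1.ne', Real.rpow_neg hR0.le]
  set Q : Set (SpaceTime n) := Metric.closedBall 0 (2 * T) ×ˢ Metric.closedBall 0 R with hQ
  have hQc : IsCompact Q := (isCompact_closedBall _ _).prod (isCompact_closedBall _ _)
  set f : SpaceTime n → ℝ := fun p => θ (p.1 / T) with hf
  set g : SpaceTime n → ℝ := fun p => χ (R⁻¹ • p.2) with hg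
  have hfs : ContDiff ℝ ∞ f := hθ.comp (by fun_prop)
  have hgs : ContDiff ℝ ∞ g := hχ.comp (by fun_prop)
  set Z : SpaceTime n → ℝ := fun p => f p * g p with hZ
  have hZs : ContDiff ℝ ∞ Z := hfs.mul hgs
  have hnorm : ∀ x : EuclideanSpace ℝ (Fin n), ‖R⁻¹ • x‖ = ‖x‖ / R := fun x => by
    rw [norm_smul, norm_inv, Real.norm_of_nonneg hR0.le, inv_mul_eq_div]
  have hZone : ∀ p ∈ {p : SpaceTime n | |p.1| < T ∧ ‖p.2‖ < R / 2}, Z p = 1 := by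
    rintro p ⟨h1, h2⟩
    have e1 : f p = 1 := hθone _ (by rw [abs_div, abs_of_pos hT0, div_le_one hT0]; exact h1.le)
    have e2 : g p = 1 := hχone _ (by rw [hnorm, div_le_iff₀ hR0]; linarith)
    simp only [hZ, e1, e2, mul_one]
  have hZzero : ∀ p ∉ Q, Z p = 0 := by
    intro p hp
    simp only [hQ, Set.mem_prod, mem_closedBall_zero_iff, not_and_or, not_le,
      Real.norm_eq_abs] at hp
    rcases hp with hp | hp
    · have : f p = 0 := hθzero _ (by rw [abs_div, abs_of_pos hT0, le_div_iff₀ hT0]; exact hp.le)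
      simp only [hZ, this, zero_mul]
    · have : g p = 0 := hχzero _ (by rw [hnorm, le_div_iff₀ hR0]; linarith)
      simp only [hZ, this, mul_zero]
  have htsupp : tsupport Z ⊆ Q :=
    closure_minimal (fun p hp => by_contra fun h => hp (hZzero p h)) hQc.isClosed
  have hKo : IsOpen {p : SpaceTime n | |p.1| < T ∧ ‖p.2‖ < R / 2} := by
    have h1 : IsOpen {p : SpaceTime n | |p.1| < T} := isOpen_lt (by fun_prop) (by fun_prop)
    have h2 : IsOpen {p : SpaceTime n | ‖p.2‖ < R / 2} := isOpen_lt (by fun_prop) (by fun_prop)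
    exact h1.inter h2
  have hfd : Differentiable ℝ f := hfs.differentiable (by simp)
  have hgd : Differentiable ℝ g := hgs.differentiable (by simp)
  have hlin : ∀ p : SpaceTime n, HasFDerivAt (fun p : SpaceTime n => p.1 / T)
      (T⁻¹ • ContinuousLinearMap.fst ℝ ℝ (EuclideanSpace ℝ (Fin n))) p := fun p => by
    have := (ContinuousLinearMap.fst ℝ ℝ (EuclideanSpace ℝ (Fin n))).hasFDerivAt
      (x := p) |>.const_mul T⁻¹
    refine this.congr_of_eventuallyEq (Eventually.of_forall fun x => ?_)
    simp [div_eq_inv_mul]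
  have hft : ∀ p, timeDeriv f p = deriv θ (p.1 / T) * T⁻¹ := fun p => by
    rw [hf, timeDeriv_comp (h := θ) (hθ.differentiable (by simp) _).hasDerivAt
      (hlin p).differentiableAt]
    simp [timeDeriv, (hlin p).fderiv]
  have hfx : ∀ p, spaceGrad f p = 0 := fun p => by
    rw [hf, spaceGrad_comp (h := θ) (hθ.differentiable (by simp) _).hasDerivAt
      (hlin p).differentiableAt]
    ext i
    simp [spaceGrad, (hlin p).fderiv]
  have hgD : ∀ p v, fderiv ℝ g p v = R⁻¹ * fderiv ℝ χ (R⁻¹ • p.2) v.2 := fun p v => by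
    have h1 : HasFDerivAt (fun p : SpaceTime n => R⁻¹ • p.2)
        (R⁻¹ • ContinuousLinearMap.snd ℝ ℝ (EuclideanSpace ℝ (Fin n))) p :=
      (ContinuousLinearMap.snd ℝ ℝ (EuclideanSpace ℝ (Fin n))).hasFDerivAt.const_smul R⁻¹
    have h2 := ((hχ.differentiable (by simp) (R⁻¹ • p.2)).hasFDerivAt.comp p h1).fderiv
    have h3 : fderiv ℝ g p = _ := h2
    rw [h3]
    simp
  have hgt : ∀ p, timeDeriv g p = 0 := fun p => by simp [timeDeriv, hgD]
  have hgx : ∀ p, spaceGrad g p = R⁻¹ • (WithLp.toLp 2 fun i =>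
      fderiv ℝ χ (R⁻¹ • p.2) (EuclideanSpace.single i 1) : EuclideanSpace ℝ (Fin n)) := fun p => by
    ext i; simp [spaceGrad, hgD]
  have hf01 : ∀ p, 0 ≤ f p ∧ f p ≤ 1 := fun p => ⟨hθ0 _, hθ1 _⟩
  have hg01 : ∀ p, 0 ≤ g p ∧ g p ≤ 1 := fun p => ⟨hχ0 _, hχ1 _⟩
  have hN0 : 0 ≤ N := (norm_nonneg _).trans (hN 0)
  refine ⟨e, Q, Z, he0, hZs, ?_, fun p => mul_nonneg (hf01 p).1 (hg01 p).1,
    fun p => mul_le_one₀ (hf01 p).2 (hg01 p).1 (hg01 p).2, hZone, hZzero, hKo.measurableSet,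
    hQc.isClosed.measurableSet, fun p hp => ?_, fun p hp => ?_, fun p => ?_, ?_, ?_⟩
  · exact hQc.of_isClosed_subset (isClosed_tsupport _) htsupp
  · by_cases hpQ : p ∈ Q
    · have hpK : p ∈ {p : SpaceTime n | |p.1| < T ∧ ‖p.2‖ < R / 2} := by
        by_contra h; exact hp ⟨hpQ, h⟩
      rw [timeDeriv_congr (g := fun _ => 1)
        (by filter_upwards [hKo.mem_nhds hpK] with x hx using hZone x hx)]
      exact timeDeriv_const 1
    · exact timeDeriv_eq_zero_of_notMem fun h => hpQ (htsupp h)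
  · by_cases hpQ : p ∈ Q
    · have hpK : p ∈ {p : SpaceTime n | |p.1| < T ∧ ‖p.2‖ < R / 2} := by
        by_contra h; exact hp ⟨hpQ, h⟩
      rw [spaceGrad_congr (g := fun _ => 1)
        (by filter_upwards [hKo.mem_nhds hpK] with x hx using hZone x hx)]
      exact spaceGrad_const 1
    · exact spaceGrad_eq_zero_of_notMem fun h => hpQ (htsupp h)
  · rw [hZ, timeDeriv_mul (hfd p) (hgd p), hgt, hft, mul_zero, zero_add, abs_mul, abs_mul,
      abs_of_nonneg (hg01 p).1, abs_of_pos (inv_pos.2 hT0), heq]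
    calc g p * (|deriv θ (p.1 / T)| * T⁻¹) ≤ 1 * (M * T⁻¹) := by
          gcongr
          · exact (hg01 p).2
          · exact hM _
      _ ≤ _ := by
          rw [one_mul]
          gcongr
          have : 0 ≤ c * N ^ 2 := by positivity
          linarith
  · have hmeas : MeasurableSet {p : SpaceTime n | R / 2 < ‖p.2‖ ∧ ‖p.2‖ < R} := by
      have h1 : IsOpen {p : SpaceTime n | R / 2 < ‖p.2‖} := isOpen_lt (by fun_prop) (by fun_prop)
      have h2 : IsOpen {p : SpaceTime n | ‖p.2‖ < R} := isOpen_lt (by fun_prop) (by fun_prop)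
      exact (h1.inter h2).measurableSet
    have hess := (ae_restrict_iff' hmeas).1 (ENNReal.ae_le_essSup (μ := volume.restrict
      {p : SpaceTime n | R / 2 < ‖p.2‖ ∧ ‖p.2‖ < R}) fun p => ENNReal.ofReal (A p))
    filter_upwards [hess, ha.form_le] with p hp hform
    have hgrad : spaceGrad Z p = (f p * R⁻¹) • (WithLp.toLp 2 fun i =>
        fderiv ℝ χ (R⁻¹ • p.2) (EuclideanSpace.single i 1) : EuclideanSpace ℝ (Fin n)) := by
      rw [hZ, spaceGrad_mul (hfd p) (hgd p), hfx, hgx, smul_zero, add_zero, smul_smul]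
    by_cases hann : R / 2 < ‖p.2‖ ∧ ‖p.2‖ < R
    · have hAp : A p ≤ c * R ^ (2 - α) := by
        have h1 := (hp hann).trans (hA R hR)
        exact (ENNReal.ofReal_le_ofReal_iff (by positivity)).1 h1
      have hns : ‖spaceGrad Z p‖ ≤ R⁻¹ * N := by
        rw [hgrad, norm_smul, norm_mul, Real.norm_of_nonneg (hf01 p).1,
          Real.norm_of_nonneg (inv_nonneg.2 hR0.le)]
        calc _ ≤ 1 * R⁻¹ * N := by
              gcongr
              · exact (hf01 p).2
              · exact hN _
          _ = _ := by ring
      have hRα : R ^ (2 - α) * R⁻¹ ^ 2 = T⁻¹ := by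
        rw [hT, Real.rpow_sub hR0, Real.rpow_ofNat]
        field_simp
      calc _ ≤ A p * ‖spaceGrad Z p‖ ^ 2 := hform _
        _ ≤ c * R ^ (2 - α) * (R⁻¹ * N) ^ 2 := by gcongr
        _ = c * N ^ 2 * (R ^ (2 - α) * R⁻¹ ^ 2) := by ring
        _ ≤ _ := by
          rw [hRα, heq]
          gcongr
          linarith
    · have : fderiv ℝ χ (R⁻¹ • p.2) = 0 := by
        refine hχann _ fun h => hann ?_
        rw [hnorm, lt_div_iff₀ hR0, div_lt_one hR0] at h
        exact ⟨by linarith [h.1], h.2⟩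
      have h0 : spaceGrad Z p = 0 := by
        rw [hgrad, this]
        ext i
        simp
      rw [h0]
      have : bilin (a p) 0 0 = 0 := by simp [bilin]
      rw [this]
      positivity
  · have hn0 : (0 : ℝ) < n := by exact_mod_cast hn
    have hexp : α + n ≤ α / (q - 1) * q := by
      have h1 : (q - 1) * n ≤ α := by
        rw [← le_div_iff₀ hn0]; linarith
      rw [div_mul_eq_mul_div, le_div_iff₀ hq1]
      linarith
    have hTR : T * R ^ n ≤ e ^ (-q) := by
      rw [hT, he, ← Real.rpow_natCast, ← Real.rpow_add hR0, ← Real.rpow_mul hR0.le, neg_mul_neg]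
      exact Real.rpow_le_rpow_of_exponent_le hR.le hexp
    have hball : volume (Metric.closedBall (0 : EuclideanSpace ℝ (Fin n)) R)
        = ENNReal.ofReal (R ^ n * V) := by
      rw [Measure.addHaar_closedBall _ _ hR0.le, finrank_euclideanSpace_fin,
        ENNReal.ofReal_mul (by positivity), hV, ofReal_measureReal measure_ball_lt_top.ne]
    rw [hQ, Measure.volume_eq_prod, Measure.prod_prod, Real.volume_closedBall, hball,
      ← ENNReal.ofReal_mul (by positivity)]
    refine ENNReal.ofReal_le_ofReal ?_
    calc 2 * (2 * T) * (R ^ n * V) = 4 * V * (T * R ^ n) := by ring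
      _ ≤ 4 * V * e ^ (-q) := by gcongr
      _ ≤ _ := by
        gcongr
        have : 0 ≤ c * N ^ 2 := by positivity
        linarith

end Cutoff

end ParabolicLiouville

end

theorem theorem2 (n : ℕ) (hn : 1 ≤ n) (α q : ℝ) (hα : 0 < α) (hq : 1 < q) (hqα : q ≤ 1 + α / n)
    (a : ParabolicLiouville.SpaceTime n → Matrix (Fin n) (Fin n) ℝ)
    (A : ParabolicLiouville.SpaceTime n → ℝ)
    (ha : ParabolicLiouville.IsCoefficient a A)
    (c : ℝ) (hc : 0 < c)
    (hA : ∀ R : ℝ, 1 < R →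
      ParabolicLiouville.annulusSup A R ≤ ENNReal.ofReal (c * R ^ (2 - α)))
    (u v : ParabolicLiouville.SpaceTime n → ℝ)
    (hu : ParabolicLiouville.IsWeakSupersolution a q u)
    (hv : ParabolicLiouville.IsWeakSubsolution a q v)
    (huv : ∀ᵐ p, v p ≤ u p) :
    ∀ᵐ p, u p = v p := by
  obtain ⟨s, G, hw⟩ := ParabolicLiouville.exists_weakInequality hq ha hu hv huv
  obtain ⟨C, hC, hcut⟩ := ParabolicLiouville.exists_isCutoff hn hq hqα ha hc hA
  have h : ∀ᵐ p, u p - v p = 0 := by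
    refine hw.ae_eq_zero hq ha (by positivity) hC
      (K := fun k : ℕ => {p | |p.1| < ((k : ℝ) + 2) ^ α ∧ ‖p.2‖ < ((k : ℝ) + 2) / 2})
      (fun p => ?_) fun k => hcut _ (by have := k.cast_nonneg (α := ℝ); linarith)
    have h1 : Tendsto (fun k : ℕ => (k : ℝ) + 2) atTop atTop :=
      tendsto_atTop_add_const_right _ _ tendsto_natCast_atTop_atTop
    filter_upwards [((tendsto_rpow_atTop hα).comp h1).eventually_gt_atTop |p.1|,
      (h1.atTop_div_const two_pos).eventually_gt_atTop ‖p.2‖] with k hk hk' using ⟨hk, hk'⟩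
  filter_upwards [h] with p hp using sub_eq_zero.1 hp
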